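/- Let $d\ge 1$ be an integer and let $(\Gamma,\mathrm{dist})$ be a metric space for which there are constants $C,K>0$ such that, with $B_j(r):=\{i\in\Gamma:\mathrm{dist}(j,i)\le r-1\}$ (a finite set; $B_j(0)=\emptyset$) and $\partial B_j(r):=B_j(r)\setminus B_j(r-1)$, $$|B_j(r+1)|\le C\,r^{d},\qquad |\partial B_j(r+1)|\le K\,r^{d-1}\qquad\text{for all } j\in\Gamma,\ r\in\{1,2,\dots\};$$ for example $\Gamma=\mathbb Z^d$ with the Euclidean metric. To each $j\in\Gamma$ attach the matrix algebra $\mathrm{Mat}_{n_j}(\mathbb C)$ with $n_j\ge1$, put $\mathbb A(\Lambda)=\bigotimes_{j\in\Lambda}\mathrm{Mat}_{n_j}(\mathbb C)$ for finite $\Lambda\subset\Gamma$, and let $\mathbb A$ be the quasi-local $C^*$-algebra, i.e. the norm completion of the increasing union of the algebras $\mathbb A(\Lambda)$. Let $\alpha$ be a $*$-automorphism of $\mathbb A$. Denote by $\mathcal S(\mathbb N_0)$ the set of sequences $g$ with $\sup_{r\ge0}(1+r)^k|g(r)|<\infty$ for every $k\in\mathbb N_0$. * For $s\ge1$ let $H_\alpha(s,0)=1$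 and, for $r\ge 1$, $$H_\alpha(s,r)=\sup_{p\in\Gamma}\ \sup_{A\in\mathbb A(B_p(s)),\,\|A\|=1}\ \inf_{B\in\mathbb A(B_p(s+r))}\|\alpha(A)-B\|.$$ The automorphism $\alpha$ is *almost locality preserving* (ALP) if there is a real sequence $f\in\mathcal S(\mathbb N_0)$ with $H_\alpha(s,r)\le s^{d-1}f(r)$ for all $s\ge1$, $r\ge0$. * A function $F:[0,\infty)\to[0,\infty)$ is *reproducing* if $\sup_{x}\sum_{y}F(\mathrm{dist}(x,y))<\infty$ and $\sup_{x,y}\sum_z \frac{F(\mathrm{dist}(x,z))F(\mathrm{dist}(z,y))}{F(\mathrm{dist}(x,y))}<\infty$ (with $0/0=0$ and $a/0=\infty$ for $a>0$). The automorphism $\alpha$ is of *Lieb–Robinson type* if there is a monotonically decreasing (not necessarily strictly) reproducing function $F$ such that (i) $\displaystyle\|[\alpha(A),B]\|\le\|A\|\,\|B\|\sum_{i\in\Lambda}\sum_{j\in\Sigma}F(\mathrm{dist}(i,j))$ for all finite $\Lambda,\Sigma\subset\Gamma$, $A\in\mathbb A(\Lambda)$, $B\in\mathbb A(\Sigma)$;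 (ii) the function $f_F(t)=K^2\sum_{k,l\ge1}(t+k+l-1)^{d-1}F(t+k+l-2)$ is finite for all $t\in\mathbb N_0$ and belongs to $\mathcal S(\mathbb N_0)$. Then: 1. If $\alpha$ is ALP, then $\alpha$ is of Lieb–Robinson type, and the function $F$ in (i), (ii) can be chosen rapidly decaying, i.e. such that $(F(r))_{r\in\mathbb N_0}\in\mathcal S(\mathbb N_0)$. 2. $\alpha$ is of Lieb–Robinson type if and only if it is ALP. -/

import Mathlib

noncomputable section

open scoped NNReal ENNReal

namespace SpinLattice

/-! ### The lattice -/

section Lattice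

/-- Every ball of the metric space `Γ` contains only finitely many points. -/
class FiniteBalls (Γ : Type*) [MetricSpace Γ] : Prop where
  finite_ball : ∀ (j : Γ) (R : ℝ), {i : Γ | dist j i ≤ R}.Finite

variable {Γ : Type*} [MetricSpace Γ] [FiniteBalls Γ]

/-- The ball `B_j(r) = {i | d(j,i) ≤ r - 1}`; in particular `B_j(0) = ∅` and `B_j(1) = {j}`. -/
def ball (j : Γ) (r : ℕ) : Finset Γ :=
  (FiniteBalls.finite_ball j ((r : ℝ) - 1)).toFinset

theorem mem_ball {j i : Γ} {r : ℕ} : i ∈ ball j r ↔ dist j i ≤ (r : ℝ) - 1 := by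
  simp [ball]

/-- The sphere `∂B_j(r) = B_j(r) \ B_j(r - 1)`. -/
def sphere [DecidableEq Γ] (j : Γ) (r : ℕ) : Finset Γ :=
  ball j r \ ball j (r - 1)

/-- The two growth conditions on a `d`-dimensional lattice `Γ`: balls of radius `r` have at most
`C r ^ d` points, and spheres of radius `r` have at most `K r ^ (d - 1)` points. -/
structure PolynomialGrowth (Γ : Type*) [MetricSpace Γ] [FiniteBalls Γ] [DecidableEq Γ]
    (d : ℕ) (C K : ℝ) : Prop where
  C_pos : 0 < C
  K_pos : 0 < K
  card_ball_le : ∀ (j : Γ) (r : ℕ), 1 ≤ r → ((ball j (r + 1)).card : ℝ) ≤ C * (r : ℝ) ^ d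
  card_sphere_le :
    ∀ (j : Γ) (r : ℕ), 1 ≤ r → ((sphere j (r + 1)).card : ℝ) ≤ K * (r : ℝ) ^ (d - 1)

end Lattice

/-! ### The lattice `ℤ^d` with the Euclidean metric satisfies the growth conditions -/

section Cubic

/-- The lattice `ℤ^d`, with the metric that it inherits from Euclidean space. -/
def CubicLattice (d : ℕ) : Type := Fin d → ℤ

instance (d : ℕ) : DecidableEq (CubicLattice d) := inferInstanceAs (DecidableEq (Fin d → ℤ))

/-- The inclusion of `ℤ^d` into Euclidean space. -/
def CubicLattice.toEuclidean {d : ℕ} (x : CubicLattice d) : EuclideanSpace ℝ (Fin d) :=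
  WithLp.toLp 2 fun i => (x i : ℝ)

theorem CubicLattice.toEuclidean_injective {d : ℕ} :
    Function.Injective (CubicLattice.toEuclidean (d := d)) := by
  intro x y h
  funext i
  have := congrArg (fun v : EuclideanSpace ℝ (Fin d) => v i) h
  simpa [CubicLattice.toEuclidean] using this

instance (d : ℕ) : MetricSpace (CubicLattice d) :=
  MetricSpace.induced CubicLattice.toEuclidean CubicLattice.toEuclidean_injective inferInstance

variable {d : ℕ}

theorem CubicLattice.dist_sq (x y : CubicLattice d) :
    dist x y ^ 2 = ((∑ i, (x i - y i) ^ 2 : ℤ) : ℝ) := by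
  change dist x.toEuclidean y.toEuclidean ^ 2 = _
  rw [EuclideanSpace.dist_eq, Real.sq_sqrt (Finset.sum_nonneg fun i _ => sq_nonneg _)]
  push_cast
  refine Finset.sum_congr rfl fun i _ => ?_
  simp [CubicLattice.toEuclidean, Real.dist_eq, sq_abs]

theorem CubicLattice.dist_le_iff (x y : CubicLattice d) (r : ℕ) :
    dist x y ≤ r ↔ ∑ i, (x i - y i) ^ 2 ≤ (r : ℤ) ^ 2 := by
  rw [← sq_le_sq₀ dist_nonneg (Nat.cast_nonneg r), CubicLattice.dist_sq]
  exact_mod_cast Iff.rfl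

theorem CubicLattice.coord_mem {x y : CubicLattice d} {r : ℕ}
    (h : ∑ i, (x i - y i) ^ 2 ≤ (r : ℤ) ^ 2) (i : Fin d) :
    y i - x i ∈ Finset.Icc (-(r : ℤ)) r := by
  have h1 : (x i - y i) ^ 2 ≤ (r : ℤ) ^ 2 :=
    (Finset.single_le_sum (f := fun i => (x i - y i) ^ 2) (fun j _ => sq_nonneg _)
      (Finset.mem_univ i)).trans h
  have := abs_le_of_sq_le_sq' h1 (by positivity)
  rw [Finset.mem_Icc]
  constructor <;> linarith [this.1, this.2]

instance : FiniteBalls (CubicLattice d) where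
  finite_ball x R := by
    obtain ⟨r, hr⟩ := exists_nat_ge R
    refine Set.Finite.subset (Set.Finite.image (fun (v : Fin d → ℤ) i => x i + v i)
      (Fintype.piFinset fun _ : Fin d => Finset.Icc (-(r : ℤ)) r).finite_toSet) ?_
    intro y hy
    refine ⟨fun i => y i - x i, ?_, ?_⟩
    · rw [Finset.mem_coe, Fintype.mem_piFinset]
      exact CubicLattice.coord_mem ((CubicLattice.dist_le_iff x y r).1 (le_trans hy hr))
    · funext i; simp

theorem CubicLattice.mem_ball_succ {x y : CubicLattice d} {r : ℕ} :
    y ∈ ball x (r + 1) ↔ ∑ i, (x i - y i) ^ 2 ≤ (r : ℤ) ^ 2 := by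
  rw [mem_ball, ← CubicLattice.dist_le_iff]
  simp

theorem CubicLattice.card_ball_le (x : CubicLattice d) {r : ℕ} (hr : 1 ≤ r) :
    (ball x (r + 1)).card ≤ 3 ^ d * r ^ d := by
  have h : (ball x (r + 1)).card ≤
      (Fintype.piFinset fun _ : Fin d => Finset.Icc (-(r : ℤ)) r).card := by
    refine Finset.card_le_card_of_injOn (fun y i => y i - x i) ?_ ?_
    · intro y hy
      rw [Finset.mem_coe, Fintype.mem_piFinset]
      exact CubicLattice.coord_mem (CubicLattice.mem_ball_succ.1 hy)
    · intro y _ z _ h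
      funext i
      have := congrFun h i
      simp only at this
      linarith
  refine h.trans ?_
  rw [Fintype.card_piFinset_const, Int.card_Icc, ← mul_pow]
  gcongr
  omega

theorem CubicLattice.coord_close {m : ℕ} {r p q : ℤ} {a b : ℤ} (hr : 1 ≤ r)
    (hpq : 0 ≤ p * q) (hp : a ≤ (m + 1) * p ^ 2) (hq : b ≤ (m + 1) * q ^ 2)
    (hab : p ^ 2 - q ^ 2 = a - b) (ha : (r - 1) ^ 2 < a) (hb : (r - 1) ^ 2 < b)
    (ha' : a ≤ r ^ 2) (hb' : b ≤ r ^ 2) (hpr : p ^ 2 ≤ r ^ 2) (hqr : q ^ 2 ≤ r ^ 2) :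
    |p - q| < 5 * (m + 1) := by
  have hm : (0 : ℤ) ≤ m := Int.natCast_nonneg m
  refine abs_lt_of_sq_lt_sq ?_ (by positivity)
  rcases hr.eq_or_lt with rfl | hr2
  · nlinarith
  · have h1 : (p - q) ^ 2 * (p + q) ^ 2 ≤ (2 * r - 1) ^ 2 := by
      have : (p - q) ^ 2 * (p + q) ^ 2 = (a - b) ^ 2 := by rw [← hab]; ring
      rw [this]
      apply sq_le_sq' <;> nlinarith
    have h2 : 2 * (r - 1) ^ 2 ≤ (m + 1) * (p + q) ^ 2 := by nlinarith
    have h3 : (2 * r - 1) ^ 2 ≤ 9 * (r - 1) ^ 2 := by nlinarith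
    have h4 : (p - q) ^ 2 * (2 * (r - 1) ^ 2) ≤ (m + 1) * (9 * (r - 1) ^ 2) :=
      calc (p - q) ^ 2 * (2 * (r - 1) ^ 2) ≤ (p - q) ^ 2 * ((m + 1) * (p + q) ^ 2) := by gcongr
        _ = (m + 1) * ((p - q) ^ 2 * (p + q) ^ 2) := by ring
        _ ≤ (m + 1) * (9 * (r - 1) ^ 2) := by
          have := h1.trans h3
          gcongr
    have h5 : (p - q) ^ 2 * 2 ≤ (m + 1) * 9 := by
      have hpos : (0 : ℤ) < (r - 1) ^ 2 := by
        have : 0 < r - 1 := by linarith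
        positivity
      refine le_of_mul_le_mul_right ?_ hpos
      linarith
    nlinarith

theorem CubicLattice.card_sphere_le {m : ℕ} (x : CubicLattice (m + 1)) {r : ℕ} (hr : 1 ≤ r) :
    (sphere x (r + 1)).card ≤ (m + 1) * (2 * (5 * (m + 1))) * 3 ^ m * r ^ m := by
  have hmax : ∀ y : CubicLattice (m + 1), ∃ i, ∑ j, (x j - y j) ^ 2 ≤
      ((m : ℤ) + 1) * (y i - x i) ^ 2 := by
    intro y
    obtain ⟨i, -, hi⟩ := Finset.exists_max_image (Finset.univ : Finset (Fin (m + 1)))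
      (fun j => (x j - y j) ^ 2) Finset.univ_nonempty
    refine ⟨i, ?_⟩
    have := Finset.sum_le_card_nsmul _ _ _ hi
    rw [Finset.card_univ, Fintype.card_fin, nsmul_eq_mul] at this
    push_cast at this
    rwa [sub_sq_comm (y i)]
  choose c hc using hmax
  have hsph : ∀ y ∈ sphere x (r + 1), ((r : ℤ) - 1) ^ 2 < ∑ j, (x j - y j) ^ 2 ∧
      ∑ j, (x j - y j) ^ 2 ≤ (r : ℤ) ^ 2 := by
    intro y hy
    rw [sphere, Finset.mem_sdiff, CubicLattice.mem_ball_succ, Nat.add_sub_cancel] at hy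
    refine ⟨?_, hy.1⟩
    obtain ⟨r', rfl⟩ : ∃ r', r = r' + 1 := ⟨r - 1, by omega⟩
    have := hy.2
    rw [CubicLattice.mem_ball_succ, not_le] at this
    simpa using this
  let T : Finset (Fin (m + 1) × Bool × ℤ × (Fin m → ℤ)) :=
    Finset.univ ×ˢ Finset.univ ×ˢ Finset.Ico 0 (5 * ((m : ℤ) + 1)) ×ˢ
      Fintype.piFinset fun _ : Fin m => Finset.Icc (-(r : ℤ)) r
  have h : (sphere x (r + 1)).card ≤ T.card := by
    refine Finset.card_le_card_of_injOn
      (fun y => (c y, decide (0 ≤ y (c y) - x (c y)), (y (c y) - x (c y)) % (5 * ((m : ℤ) + 1)),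
        fun j => y ((c y).succAbove j) - x ((c y).succAbove j))) ?_ ?_
    · intro y hy
      have h2 := (hsph y hy).2
      simp only [T, Finset.coe_product, Set.mem_prod, Finset.mem_coe, Finset.mem_univ, true_and,
        Finset.mem_Ico, Fintype.mem_piFinset]
      exact ⟨⟨Int.emod_nonneg _ (by positivity), Int.emod_lt_of_pos _ (by positivity)⟩,
        fun j => CubicLattice.coord_mem h2 _⟩
    · intro y hy z hz hyz
      simp only [Prod.mk.injEq, decide_eq_decide] at hyz
      obtain ⟨hi, hs, hmod, hoff⟩ := hyz
      have hcy := hc y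
      have hcz := hc z
      rw [← hi] at hs hmod hoff hcz
      generalize c y = i at *
      have hoff' : ∀ j, y (i.succAbove j) = z (i.succAbove j) := fun j => by
        have : y (i.succAbove j) - x (i.succAbove j) = z (i.succAbove j) - x (i.succAbove j) :=
          congrFun hoff j
        linarith
      have hsy := hsph y hy
      have hsz := hsph z hz
      have hp : (y i - x i) ^ 2 ≤ (r : ℤ) ^ 2 := by
        have := Finset.mem_Icc.1 (CubicLattice.coord_mem hsy.2 i)
        exact sq_le_sq' this.1 this.2
      have hq : (z i - x i) ^ 2 ≤ (r : ℤ) ^ 2 := by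
        have := Finset.mem_Icc.1 (CubicLattice.coord_mem hsz.2 i)
        exact sq_le_sq' this.1 this.2
      have hab : (y i - x i) ^ 2 - (z i - x i) ^ 2 =
          ∑ j, (x j - y j) ^ 2 - ∑ j, (x j - z j) ^ 2 := by
        rw [Fin.sum_univ_succAbove _ i, Fin.sum_univ_succAbove (fun j => (x j - z j) ^ 2) i,
          Finset.sum_congr rfl fun j _ => by rw [hoff' j]]
        ring
      have hpq : 0 ≤ (y i - x i) * (z i - x i) := by
        by_cases h0 : 0 ≤ y i - x i
        · exact mul_nonneg h0 (hs.1 h0)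
        · have h0' : ¬ 0 ≤ z i - x i := fun h => h0 (hs.2 h)
          exact mul_nonneg_of_nonpos_of_nonpos (by linarith) (by linarith)
      have hclose := CubicLattice.coord_close (by exact_mod_cast hr) hpq hcy hcz hab hsy.1 hsz.1
        hsy.2 hsz.2 hp hq
      have hdvd : (5 * ((m : ℤ) + 1)) ∣ (y i - x i) - (z i - x i) :=
        Int.ModEq.dvd (Int.ModEq.symm hmod)
      have hzero := Int.eq_zero_of_abs_lt_dvd hdvd hclose
      funext j
      rcases Fin.eq_self_or_eq_succAbove i j with rfl | ⟨k, rfl⟩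
      · linarith
      · exact hoff' k
  refine h.trans ?_
  simp only [T, Finset.card_product, Finset.card_univ, Fintype.card_fin, Fintype.card_bool,
    Int.card_Ico, Fintype.card_piFinset_const, Int.card_Icc]
  have h1 : (5 * ((m : ℤ) + 1) - 0).toNat = 5 * (m + 1) := by omega
  have h2 : ((r : ℤ) + 1 - -(r : ℤ)).toNat ≤ 3 * r := by omega
  rw [h1]
  calc _ ≤ (m + 1) * (2 * (5 * (m + 1) * (3 * r) ^ m)) := by gcongr
    _ = _ := by rw [mul_pow]; ring

/-- For `d ≥ 1` the growth conditions hold for `ℤ^d` with the Euclidean metric. -/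
theorem CubicLattice.polynomialGrowth (hd : 1 ≤ d) :
    ∃ C K : ℝ, PolynomialGrowth (CubicLattice d) d C K := by
  obtain ⟨m, rfl⟩ : ∃ m, d = m + 1 := ⟨d - 1, by omega⟩
  refine ⟨((3 ^ (m + 1) : ℕ) : ℝ), (((m + 1) * (2 * (5 * (m + 1))) * 3 ^ m : ℕ) : ℝ),
    by positivity, by positivity, fun x r hr => ?_, fun x r hr => ?_⟩
  · exact_mod_cast CubicLattice.card_ball_le x hr
  · exact_mod_cast CubicLattice.card_sphere_le x hr

end Cubic

/-! ### The quasi-local algebra -/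

section Algebra

variable {Γ : Type*} [DecidableEq Γ]

/-- Classical spin configurations on the whole lattice; the site `j` has `n j` states. -/
abbrev Config (n : Γ → ℕ) : Type _ := ∀ j : Γ, Fin (n j)

/-- Spin configurations on the finite region `Λ`. -/
abbrev LocalConfig (n : Γ → ℕ) (Λ : Finset Γ) : Type _ := ∀ j : Λ, Fin (n j)

variable {n : Γ → ℕ}

/-- The restriction of a configuration to `Λ`. -/
def restrict (Λ : Finset Γ) (σ : Config n) : LocalConfig n Λ := fun j => σ j

/-- The configuration that equals `b` on `Λ` and `σ` outside of `Λ`. -/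
def overwrite {Λ : Finset Γ} (σ : Config n) (b : LocalConfig n Λ) : Config n :=
  fun j => if h : j ∈ Λ then b ⟨j, h⟩ else σ j

@[simp] theorem restrict_overwrite {Λ : Finset Γ} (σ : Config n) (b : LocalConfig n Λ) :
    restrict Λ (overwrite σ b) = b := by
  funext j; simp [restrict, overwrite]

@[simp] theorem overwrite_overwrite {Λ : Finset Γ} (σ : Config n) (b c : LocalConfig n Λ) :
    overwrite (overwrite σ b) c = overwrite σ c := by
  funext j; by_cases h : j ∈ Λ <;> simp [overwrite, h]

@[simp] theorem overwrite_restrict {Λ : Finset Γ} (σ : Config n) :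
    overwrite σ (restrict Λ σ) = σ := by
  funext j; simp [restrict, overwrite]

theorem overwrite_eq_self {Λ : Finset Γ} {σ : Config n} {a : LocalConfig n Λ}
    (h : restrict Λ σ = a) : overwrite σ a = σ := by
  subst h; simp

/-- The Hilbert space `ℓ²` over the configurations, on which all observables act. -/
abbrev HilbertSp (n : Γ → ℕ) : Type _ := lp (fun _ : Config n => ℂ) 2

theorem summable_normSq {ι : Type*} (ψ : lp (fun _ : ι => ℂ) 2) :
    Summable fun σ => ‖ψ σ‖ ^ (2 : ℝ) := by
  simpa using (lp.memℓp ψ).summable (by norm_num)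

theorem overwrite_injOn {Λ : Finset Γ} (a b : LocalConfig n Λ) :
    Function.Injective
      (fun σ : {σ : Config n | restrict Λ σ = a} => overwrite (σ : Config n) b) := by
  rintro ⟨σ, hσ⟩ ⟨τ, hτ⟩ h
  simp only [Set.mem_ofPred_eq] at hσ hτ
  have h2 := congrArg (fun ρ => overwrite ρ a) h
  simp only [overwrite_overwrite] at h2
  rw [overwrite_eq_self hσ, overwrite_eq_self hτ] at h2
  exact Subtype.ext h2

/-- The function `σ ↦ ψ(b on Λ, σ off Λ)` if `σ = a` on `Λ`, and `0` otherwise. -/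
def matrixUnitFun {Λ : Finset Γ} (a b : LocalConfig n Λ) (ψ : Config n → ℂ) : Config n → ℂ :=
  fun σ => if restrict Λ σ = a then ψ (overwrite σ b) else 0

theorem norm_matrixUnitFun {Λ : Finset Γ} (a b : LocalConfig n Λ) (ψ : Config n → ℂ) :
    (fun σ => ‖matrixUnitFun a b ψ σ‖ ^ (2 : ℝ)) =
      Set.indicator {σ : Config n | restrict Λ σ = a}
        (fun σ => ‖ψ (overwrite σ b)‖ ^ (2 : ℝ)) := by
  funext σ
  by_cases h : restrict Λ σ = a <;> simp [matrixUnitFun, Set.indicator, h]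

theorem summable_matrixUnitFun {Λ : Finset Γ} (a b : LocalConfig n Λ) (ψ : HilbertSp n) :
    Summable fun σ => ‖matrixUnitFun a b ψ σ‖ ^ (2 : ℝ) := by
  rw [norm_matrixUnitFun, ← summable_subtype_iff_indicator]
  exact (summable_normSq ψ).comp_injective (overwrite_injOn a b)

theorem memℓp_matrixUnitFun {Λ : Finset Γ} (a b : LocalConfig n Λ) (ψ : HilbertSp n) :
    Memℓp (matrixUnitFun a b ψ) 2 := by
  refine memℓp_gen ?_
  simpa using summable_matrixUnitFun a b ψ

/-- The matrix unit `|a⟩⟨b| ⊗ 1` of the region `Λ`, as a bounded operator on the Hilbert space. -/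
def matrixUnit {Λ : Finset Γ} (a b : LocalConfig n Λ) : HilbertSp n →L[ℂ] HilbertSp n :=
  LinearMap.mkContinuous
    { toFun := fun ψ => ⟨matrixUnitFun a b ψ, memℓp_matrixUnitFun a b ψ⟩
      map_add' := by
        intro ψ φ; ext σ
        change matrixUnitFun a b _ σ = matrixUnitFun a b _ σ + matrixUnitFun a b _ σ
        by_cases h : restrict Λ σ = a <;> simp [matrixUnitFun, h]
      map_smul' := by
        intro c ψ; ext σ
        by_cases h : restrict Λ σ = a <;> simp [matrixUnitFun, h] }
    1 (by
      intro ψ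
      rw [one_mul]
      refine lp.norm_le_of_tsum_le (by norm_num) (norm_nonneg _) ?_
      rw [lp.norm_rpow_eq_tsum (by norm_num) ψ]
      simp only [ENNReal.toReal_ofNat]
      change ∑' σ, ‖matrixUnitFun a b ψ σ‖ ^ (2 : ℝ) ≤ _
      rw [norm_matrixUnitFun, ← tsum_subtype]
      exact tsum_comp_le_tsum_of_inj (summable_normSq ψ)
        (fun σ => by positivity) (overwrite_injOn a b))

@[simp] theorem matrixUnit_apply {Λ : Finset Γ} (a b : LocalConfig n Λ) (ψ : HilbertSp n)
    (σ : Config n) :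
    matrixUnit a b ψ σ = if restrict Λ σ = a then ψ (overwrite σ b) else 0 := rfl

theorem matrixUnit_mul {Λ : Finset Γ} (a b c e : LocalConfig n Λ) :
    matrixUnit a b * matrixUnit c e = if b = c then matrixUnit (n := n) a e else 0 := by
  ext ψ σ
  by_cases h : restrict Λ σ = a <;> by_cases h' : b = c <;> simp [h, h']

theorem star_matrixUnit {Λ : Finset Γ} (a b : LocalConfig n Λ) :
    star (matrixUnit (n := n) a b) = matrixUnit b a := by
  symm
  rw [ContinuousLinearMap.star_eq_adjoint, ContinuousLinearMap.eq_adjoint_iff]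
  intro ψ φ
  rw [lp.inner_eq_tsum, lp.inner_eq_tsum]
  have h1 : (fun σ => inner ℂ (matrixUnit b a ψ σ) (φ σ)) =
      Set.indicator {σ : Config n | restrict Λ σ = b}
        (fun σ => inner ℂ (ψ (overwrite σ a)) (φ σ)) := by
    funext σ; by_cases h : restrict Λ σ = b <;> simp [Set.indicator, h]
  have h2 : (fun σ => inner ℂ (ψ σ) (matrixUnit a b φ σ)) =
      Set.indicator {σ : Config n | restrict Λ σ = a}
        (fun σ => inner ℂ (ψ σ) (φ (overwrite σ b))) := by
    funext σ; by_cases h : restrict Λ σ = a <;> simp [Set.indicator, h]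
  rw [h1, h2, ← tsum_subtype, ← tsum_subtype]
  let e : {σ : Config n | restrict Λ σ = b} ≃ {σ : Config n | restrict Λ σ = a} :=
    { toFun := fun σ => ⟨overwrite σ.1 a, by simp⟩
      invFun := fun σ => ⟨overwrite σ.1 b, by simp⟩
      left_inv := fun σ => Subtype.ext (by simpa using overwrite_eq_self σ.2)
      right_inv := fun σ => Subtype.ext (by simpa using overwrite_eq_self σ.2) }
  rw [← e.tsum_eq]
  refine tsum_congr fun σ => ?_
  have := overwrite_eq_self σ.2
  simp [e, this]

/-- The operator `M ⊗ 1`, for a matrix `M` indexed by the configurations on `Λ`. -/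
def localOp {Λ : Finset Γ} (M : Matrix (LocalConfig n Λ) (LocalConfig n Λ) ℂ) :
    HilbertSp n →L[ℂ] HilbertSp n :=
  ∑ a, ∑ b, M a b • matrixUnit a b

theorem localOp_apply {Λ : Finset Γ} (M : Matrix (LocalConfig n Λ) (LocalConfig n Λ) ℂ)
    (ψ : HilbertSp n) (σ : Config n) :
    localOp M ψ σ = ∑ b, M (restrict Λ σ) b * ψ (overwrite σ b) := by
  simp only [localOp, sum_apply, lp.coeFn_sum, Finset.sum_apply, smul_apply, lp.coeFn_smul,
    Pi.smul_apply, matrixUnit_apply, smul_eq_mul, mul_ite, mul_zero]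
  rw [Finset.sum_comm]
  refine Finset.sum_congr rfl fun b _ => ?_
  simp

/-- The action `M ↦ M ⊗ 1` of `⨂_{j ∈ Λ} Mat_{n j}(ℂ)`, identified with the matrices indexed by
the configurations on `Λ`, on the Hilbert space. -/
def localRep (n : Γ → ℕ) (Λ : Finset Γ) :
    Matrix (LocalConfig n Λ) (LocalConfig n Λ) ℂ →⋆ₐ[ℂ] (HilbertSp n →L[ℂ] HilbertSp n) where
  toFun M := localOp M
  map_one' := by
    ext ψ σ
    simp [localOp_apply, Matrix.one_apply]
  map_mul' M N := by
    ext ψ σ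
    simp only [localOp_apply, Matrix.mul_apply, mul_apply_eq_comp,
      restrict_overwrite, overwrite_overwrite, Finset.sum_mul, Finset.mul_sum]
    rw [Finset.sum_comm]
    simp only [mul_assoc]
  map_zero' := by simp [localOp]
  map_add' M N := by simp [localOp, add_smul, Finset.sum_add_distrib]
  commutes' c := by
    ext ψ σ
    simp [localOp_apply, Algebra.algebraMap_eq_smul_one, Matrix.one_apply]
  map_star' M := by
    simp only [localOp, star_sum, star_smul, star_matrixUnit, Matrix.star_apply]
    rw [Finset.sum_comm]

@[simp] theorem localRep_apply {Λ : Finset Γ}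
    (M : Matrix (LocalConfig n Λ) (LocalConfig n Λ) ℂ) (ψ : HilbertSp n) (σ : Config n) :
    localRep n Λ M ψ σ = ∑ b, M (restrict Λ σ) b * ψ (overwrite σ b) :=
  localOp_apply M ψ σ

/-- Every local algebra acts faithfully (hence isometrically). -/
theorem localRep_injective [∀ j, NeZero (n j)] (Λ : Finset Γ) :
    Function.Injective (localRep n Λ) := by
  classical
  rw [injective_iff_map_eq_zero]
  intro M hM
  ext a b
  let σ : Config n := overwrite (fun _ => 0) a
  have h := congrArg (fun T => T (lp.single 2 (overwrite σ b) (1 : ℂ)) σ) hM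
  simp only [localRep_apply] at h
  rw [Finset.sum_eq_single b] at h
  · simpa [σ] using h
  · intro c _ hc
    have : overwrite σ c ≠ overwrite σ b := fun hcb => hc (by
      simpa using congrArg (restrict Λ) hcb)
    simp [lp.single_apply, this]
  · simp

/-- The inclusion `M ↦ M ⊗ 1` of the matrices over `Λ` into the matrices over `Λ' ⊇ Λ`. -/
def extendMatrix {Λ Λ' : Finset Γ} (h : Λ ⊆ Λ')
    (M : Matrix (LocalConfig n Λ) (LocalConfig n Λ) ℂ) :
    Matrix (LocalConfig n Λ') (LocalConfig n Λ') ℂ :=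
  fun a b => if ∀ j : Λ', (j : Γ) ∉ Λ → a j = b j then
    M (fun j => a ⟨j, h j.2⟩) (fun j => b ⟨j, h j.2⟩) else 0

/-- The actions of the local algebras are compatible with these inclusions. -/
theorem localRep_extendMatrix {Λ Λ' : Finset Γ} (h : Λ ⊆ Λ')
    (M : Matrix (LocalConfig n Λ) (LocalConfig n Λ) ℂ) :
    localRep n Λ' (extendMatrix h M) = localRep n Λ M := by
  ext ψ σ
  simp only [localRep_apply, extendMatrix, ite_mul, zero_mul]
  rw [← Finset.sum_filter]
  refine Finset.sum_bij' (fun b _ => fun j => b ⟨j, h j.2⟩)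
    (fun c _ => restrict Λ' (overwrite σ c)) ?_ ?_ ?_ ?_ ?_
  · simp
  · intro c _
    simp only [Finset.mem_filter, Finset.mem_univ, true_and]
    intro j hj
    simp [restrict, overwrite, hj]
  · intro b hb
    simp only [Finset.mem_filter, Finset.mem_univ, true_and] at hb
    funext j
    by_cases hj : (j : Γ) ∈ Λ
    · simp [restrict, overwrite, hj]
    · simpa [restrict, overwrite, hj] using hb j hj
  · intro c _
    funext j
    simp [restrict, overwrite]
  · intro b hb
    simp only [Finset.mem_filter, Finset.mem_univ, true_and] at hb
    have hover : overwrite σ b = overwrite σ fun j : Λ => b ⟨j, h j.2⟩ := by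
      funext j
      by_cases hj : j ∈ Λ
      · simp [overwrite, hj, h hj]
      · by_cases hj' : j ∈ Λ'
        · simpa [restrict, overwrite, hj, hj'] using (hb ⟨j, hj'⟩ hj).symm
        · simp [overwrite, hj, hj']
    rw [hover]
    rfl

variable (n) in
/-- The quasi-local algebra: the norm closure of the increasing union of the local algebras. -/
def quasiLocal : StarSubalgebra ℂ (HilbertSp n →L[ℂ] HilbertSp n) :=
  (⨆ Λ : Finset Γ, (localRep n Λ).range).topologicalClosure

variable (n) in
/-- The local algebra `𝔸(Λ)`, as a subalgebra of the quasi-local algebra. -/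
def localAlg (Λ : Finset Γ) : StarSubalgebra ℂ (quasiLocal n) :=
  (localRep n Λ).range.comap (quasiLocal n).subtype

theorem localRep_mem_quasiLocal (Λ : Finset Γ)
    (M : Matrix (LocalConfig n Λ) (LocalConfig n Λ) ℂ) : localRep n Λ M ∈ quasiLocal n :=
  StarSubalgebra.le_topologicalClosure _
    ((le_iSup (fun Λ : Finset Γ => (localRep n Λ).range) Λ) ⟨M, rfl⟩)

theorem localAlg_mono {Λ Λ' : Finset Γ} (h : Λ ⊆ Λ') : localAlg n Λ ≤ localAlg n Λ' := by
  rintro A ⟨M, hM⟩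
  exact ⟨extendMatrix h M, (localRep_extendMatrix h M).trans hM⟩

end Algebra

/-! ### Rapidly decaying sequences and reproducing functions -/

/-- `g ∈ 𝒮(ℕ₀)`: the sequence `g` decays faster than every power. -/
def IsSchwartzSeq (g : ℕ → ℝ) : Prop :=
  ∀ k : ℕ, ∃ M : ℝ, ∀ r : ℕ, (1 + (r : ℝ)) ^ k * |g r| ≤ M

/-- `F : [0, ∞) → [0, ∞)` is uniformly integrable over `Γ` and satisfies the convolution
condition. Sums and quotients are taken in `[0, ∞]`, where `a / 0 = ∞` for `a ≠ 0` and
`0 / 0 = 0`. -/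
structure IsReproducing (Γ : Type*) [MetricSpace Γ] (F : ℝ≥0 → ℝ≥0) : Prop where
  integrable : (⨆ x : Γ, ∑' y : Γ, (F (nndist x y) : ℝ≥0∞)) < ⊤
  convolution : (⨆ (x : Γ) (y : Γ), ∑' z : Γ,
    (F (nndist x z) : ℝ≥0∞) * (F (nndist z y) : ℝ≥0∞) / (F (nndist x y) : ℝ≥0∞)) < ⊤

/-- `g_F(t) = ∑_{k,l ≥ 1} (t + k + l - 1)^(d-1) F(t + k + l - 2)`, with both summation indices
shifted by one. -/
def gF (d : ℕ) (F : ℝ≥0 → ℝ≥0) (t : ℕ) : ℝ≥0∞ :=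
  ∑' (k : ℕ) (l : ℕ), ((t + k + l + 1 : ℕ) : ℝ≥0∞) ^ (d - 1) * (F ((t + k + l : ℕ) : ℝ≥0) : ℝ≥0∞)

/-! ### The two classes of automorphisms -/

section Automorphisms

variable {Γ : Type*} [MetricSpace Γ] [DecidableEq Γ] {n : Γ → ℕ}

/-- The quantity `H_α(s, r)`: the supremum over the centres `p` and over the `A ∈ 𝔸(B_p(s))` of
norm one of the distance of `α(A)` from `𝔸(B_p(s + r))`, with `H_α(s, 0) = 1`. All distances are
at most `‖α(A)‖ = 1`, so that the suprema are those of bounded sets. -/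
def tailH [FiniteBalls Γ] (α : quasiLocal n ≃⋆ₐ[ℂ] quasiLocal n) (s r : ℕ) : ℝ :=
  if r = 0 then 1 else
    ⨆ p : Γ, ⨆ A : {A : quasiLocal n // A ∈ localAlg n (ball p s) ∧ ‖A‖ = 1},
      ⨅ B : localAlg n (ball p (s + r)), ‖α A - B‖

/-- `α` is almost locality preserving. -/
def IsALP [FiniteBalls Γ] (d : ℕ) (α : quasiLocal n ≃⋆ₐ[ℂ] quasiLocal n) : Prop :=
  ∃ f : ℕ → ℝ, IsSchwartzSeq f ∧
    ∀ s r : ℕ, 1 ≤ s → tailH α s r ≤ (s : ℝ) ^ (d - 1) * f r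

/-- The function `F` witnesses that `α` is of Lieb–Robinson type. -/
structure IsLRFunction (d : ℕ) (K : ℝ) (α : quasiLocal n ≃⋆ₐ[ℂ] quasiLocal n)
    (F : ℝ≥0 → ℝ≥0) : Prop where
  antitone : Antitone F
  reproducing : IsReproducing Γ F
  commutator_le : ∀ (Λ₁ Λ₂ : Finset Γ) (A B : quasiLocal n),
    A ∈ localAlg n Λ₁ → B ∈ localAlg n Λ₂ →
      ‖α A * B - B * α A‖ ≤ ‖A‖ * ‖B‖ * ∑ i ∈ Λ₁, ∑ j ∈ Λ₂, (F (nndist i j) : ℝ)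
  gF_ne_top : ∀ t, gF d F t ≠ ⊤
  schwartz : IsSchwartzSeq fun t => K ^ 2 * (gF d F t).toReal

/-- `α` is of Lieb–Robinson type. -/
def IsLiebRobinson (d : ℕ) (K : ℝ) (α : quasiLocal n ≃⋆ₐ[ℂ] quasiLocal n) : Prop :=
  ∃ F : ℝ≥0 → ℝ≥0, IsLRFunction d K α F

end Automorphisms

end SpinLattice

end

open SpinLattice
open scoped NNReal

noncomputable section

open scoped NNReal ENNReal

namespace SpinLattice

/-! ### Rapidly decaying sequences -/

section Sequences

/-! Both directions compare two measures of how far `α` spreads a local observable: the distance of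
`α A` from a local algebra, and the commutators of `α A` with distant observables.

From ALP to Lieb–Robinson: if `D` is a local approximation of `α A` whose support is disjoint from
that of `B`, then `[α A, B] = [α A - D, B]`. Applied to single sites, this bounds the commutator by
the tail function with `s = 1`. Passing from sites to arbitrary finite regions costs only a
constant: an operator that almost commutes with each site of a region is moved, one site at a time,
to an operator that commutes exactly with the algebra of the region. The total displacement is at
most twice the sum of the one-site errors, whatever the dimensions `n j`. Doing this once for `α`
and once for `α.symm` turns one-site bounds into the required double sum
(`norm_commutator_le_of_sites`). It remains to dominate a rapidly decaying sequence by a function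
that is antitone, reproducing and still rapidly decaying. A supermultiplicative majorant `Q` exists
because the sequence beats every power: the reciprocal of a product of factors `1 + x / R k` with
fast-growing `R k` works. Multiplying `Q` by a summable polynomial weight gives the convolution
estimate (`PolynomialGrowth.exists_reproducing_majorant`).

From Lieb–Robinson to ALP: an observable that almost commutes with everything outside a region is
close to the algebra of the region (`iInf_norm_sub_le_of_commutator_le`), because averaging over a
finite group of unitaries of the outside projects onto the commutant. The double sum of `F` between
a ball and the exterior of a larger ball is then organised by the depth of the first point below the
boundary and by spheres around it. Each depth holds `O(s ^ (d - 1))` points, and the two remaining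
sums are exactly those of `gF` (`PolynomialGrowth.sum_ball_sum_le`). -/

theorem IsSchwartzSeq.const_mul {f : ℕ → ℝ} (hf : IsSchwartzSeq f) (c : ℝ) :
    IsSchwartzSeq fun r => c * f r := by
  intro k
  obtain ⟨M, hM⟩ := hf k
  refine ⟨|c| * M, fun r => ?_⟩
  calc (1 + (r : ℝ)) ^ k * |c * f r| = |c| * ((1 + (r : ℝ)) ^ k * |f r|) := by
        rw [abs_mul]; ring
    _ ≤ |c| * M := by gcongr; exact hM r

theorem IsSchwartzSeq.pow_mul {f : ℕ → ℝ} (hf : IsSchwartzSeq f) (p : ℕ) :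
    IsSchwartzSeq fun r => (1 + (r : ℝ)) ^ p * f r := by
  intro k
  obtain ⟨M, hM⟩ := hf (k + p)
  refine ⟨M, fun r => ?_⟩
  have h0 : (0 : ℝ) ≤ (1 + (r : ℝ)) ^ p := by positivity
  rw [abs_mul, abs_of_nonneg h0, ← mul_assoc, ← pow_add]
  exact hM r

/-- Prepending a term to a rapidly decaying sequence. -/
theorem IsSchwartzSeq.cons {f : ℕ → ℝ} (hf : IsSchwartzSeq f) (a : ℝ) :
    IsSchwartzSeq fun r => Nat.casesOn r a f := by
  intro k
  obtain ⟨M, hM⟩ := hf k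
  refine ⟨|a| + 2 ^ k * M, fun r => ?_⟩
  have hM0 : 0 ≤ M := le_trans (by positivity) (hM 0)
  cases r with
  | zero =>
    have : 0 ≤ 2 ^ k * M := by positivity
    simpa using this
  | succ m =>
    change (1 + ((m + 1 : ℕ) : ℝ)) ^ k * |f m| ≤ _
    have h1 : (1 + ((m + 1 : ℕ) : ℝ)) ^ k ≤ 2 ^ k * (1 + (m : ℝ)) ^ k := by
      rw [← mul_pow]
      gcongr
      push_cast
      linarith [(Nat.cast_nonneg m : (0 : ℝ) ≤ m)]
    calc (1 + ((m + 1 : ℕ) : ℝ)) ^ k * |f m| ≤ 2 ^ k * (1 + (m : ℝ)) ^ k * |f m| := by gcongr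
      _ = 2 ^ k * ((1 + (m : ℝ)) ^ k * |f m|) := by ring
      _ ≤ 2 ^ k * M := by gcongr; exact hM m
      _ ≤ |a| + 2 ^ k * M := by linarith [abs_nonneg a]

/-- Changing the first term of a rapidly decaying sequence. -/
theorem IsSchwartzSeq.update_zero {f : ℕ → ℝ} (hf : IsSchwartzSeq f) (a : ℝ) :
    IsSchwartzSeq fun r => if r = 0 then a else f r := by
  intro k
  obtain ⟨M, hM⟩ := hf k
  have hM0 : 0 ≤ M := le_trans (by positivity) (hM 0)
  refine ⟨|a| + M, fun r => ?_⟩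
  by_cases hr : r = 0
  · simp [hr, hM0]
  · simp only [hr, if_false]
    linarith [hM r, abs_nonneg a]

/-- The polynomial `∏_{k < N} (1 + x / R k)`. -/
def slowProd (R : ℕ → ℝ) (N : ℕ) (x : ℝ) : ℝ := ∏ k ∈ Finset.range N, (1 + x / R k)

variable {R : ℕ → ℝ}

theorem one_le_slowProd (hR : ∀ k, 1 ≤ R k) (N : ℕ) {x : ℝ} (hx : 0 ≤ x) :
    1 ≤ slowProd R N x :=
  Finset.prod_induction _ (1 ≤ ·) (fun _ _ => one_le_mul_of_one_le_of_one_le) le_rfl fun k _ => by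
    have := div_nonneg hx (zero_le_one.trans (hR k))
    linarith

theorem slowProd_mono (hR : ∀ k, 1 ≤ R k) (N : ℕ) {x y : ℝ} (hx : 0 ≤ x) (hxy : x ≤ y) :
    slowProd R N x ≤ slowProd R N y := by
  refine Finset.prod_le_prod (fun k _ => ?_) fun k _ => ?_
  · have := div_nonneg hx (zero_le_one.trans (hR k))
    linarith
  · have := div_le_div_of_nonneg_right hxy (zero_le_one.trans (hR k))
    linarith

/-- Each factor satisfies `1 + (x + y) / R ≤ (1 + x / R) * (1 + y / R)`. Reciprocals therefore
become supermultiplicative. -/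
theorem slowProd_add_le (hR : ∀ k, 1 ≤ R k) (N : ℕ) {x y : ℝ} (hx : 0 ≤ x) (hy : 0 ≤ y) :
    slowProd R N (x + y) ≤ slowProd R N x * slowProd R N y := by
  rw [slowProd, slowProd, slowProd, ← Finset.prod_mul_distrib]
  refine Finset.prod_le_prod (fun k _ => ?_) fun k _ => ?_
  · have := div_nonneg (add_nonneg hx hy) (zero_le_one.trans (hR k))
    linarith
  · have h1 := div_nonneg hx (zero_le_one.trans (hR k))
    have h2 := div_nonneg hy (zero_le_one.trans (hR k))
    rw [add_div]
    nlinarith [mul_nonneg h1 h2]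

/-- The bound is uniform in `N`, so the infimum of the reciprocals stays strictly positive. -/
theorem slowProd_le_exp (hR : ∀ k, 2 ^ k ≤ R k) (N : ℕ) {x : ℝ} (hx : 0 ≤ x) :
    slowProd R N x ≤ Real.exp (2 * x) := by
  have h1 : slowProd R N x ≤ Real.exp (∑ k ∈ Finset.range N, x / R k) := by
    rw [Real.exp_sum]
    refine Finset.prod_le_prod (fun k _ => ?_) fun k _ => ?_
    · have := div_nonneg hx ((by positivity : (0 : ℝ) ≤ 2 ^ k).trans (hR k))
      linarith
    · linarith [Real.add_one_le_exp (x / R k)]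
  refine h1.trans (Real.exp_le_exp.2 ?_)
  calc ∑ k ∈ Finset.range N, x / R k ≤ ∑ k ∈ Finset.range N, (1 / 2 : ℝ) ^ k * x := by
        refine Finset.sum_le_sum fun k _ => ?_
        rw [div_pow, one_pow, one_div_mul_eq_div]
        exact div_le_div_of_nonneg_left hx (by positivity) (hR k)
    _ = (∑ k ∈ Finset.range N, (1 / 2 : ℝ) ^ k) * x := by rw [Finset.sum_mul]
    _ ≤ 2 * x := by
        gcongr
        exact sum_geometric_two_le N

theorem slowProd_le_pow (hR : ∀ k, 1 ≤ R k) (N : ℕ) {x : ℝ} (hx : 0 ≤ x) :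
    slowProd R N x ≤ (1 + x) ^ N := by
  have : (1 + x) ^ N = ∏ _k ∈ Finset.range N, (1 + x) := by simp
  rw [this]
  refine Finset.prod_le_prod (fun k _ => ?_) fun k _ => ?_
  · have := div_nonneg hx (zero_le_one.trans (hR k))
    linarith
  · have := div_le_self hx (hR k)
    linarith

/-- Already `N` factors grow like a polynomial of degree `N`; this makes the reciprocal decay faster
than any power. -/
theorem pow_le_slowProd (hR : ∀ k, 1 ≤ R k) (N : ℕ) {x : ℝ} (hx : 0 ≤ x) :
    (1 + x) ^ N ≤ (∏ k ∈ Finset.range N, R k) * slowProd R N x := by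
  have : (1 + x) ^ N = ∏ _k ∈ Finset.range N, (1 + x) := by simp
  rw [this, slowProd, ← Finset.prod_mul_distrib]
  refine Finset.prod_le_prod (fun k _ => by positivity) fun k _ => ?_
  have h0 : 0 < R k := zero_lt_one.trans_le (hR k)
  have h1 : R k * (1 + x / R k) = R k + x := by field_simp
  linarith [hR k]

/-- Every rapidly decaying sequence has a rapidly decaying supermultiplicative majorant. -/
theorem exists_supermultiplicative_majorant {f : ℕ → ℝ} (hf : IsSchwartzSeq f) :
    ∃ (Q : ℝ≥0 → ℝ≥0) (c : ℝ≥0), 0 < c ∧ Antitone Q ∧ (∀ x, 0 < Q x) ∧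
      (∀ x y, Q x * Q y ≤ Q (x + y)) ∧ (∀ k : ℕ, ∃ M : ℝ≥0, ∀ x, (1 + x) ^ k * Q x ≤ M) ∧
      ∀ r : ℕ, |f r| ≤ c * Q r := by
  choose M hM using hf
  -- The factor `2 ^ k` gives summability of `1 / R k`; the moment bound `M (k + 1)` lets the
  -- product be enlarged by its `k`-th factor while `f` is still dominated.
  let R : ℕ → ℝ := fun k => 2 ^ k * max 1 (M (k + 1))
  have hR2 : ∀ k, 2 ^ k ≤ R k := fun k =>
    le_mul_of_one_le_right (by positivity) (le_max_left _ _)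
  have hR : ∀ k, 1 ≤ R k := fun k => (one_le_pow₀ one_le_two).trans (hR2 k)
  have hRM : ∀ k, 2 ^ k * M (k + 1) ≤ R k := fun k =>
    mul_le_mul_of_nonneg_left (le_max_right _ _) (by positivity)
  have hpos : ∀ N (x : ℝ≥0), 0 < slowProd R N x := fun N x =>
    zero_lt_one.trans_le (one_le_slowProd hR N x.2)
  have hbd : ∀ x : ℝ≥0, BddBelow (Set.range fun N => (slowProd R N x)⁻¹) := fun x =>
    ⟨0, by rintro _ ⟨N, rfl⟩; exact (inv_pos.2 (hpos N x)).le⟩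
  let q : ℝ≥0 → ℝ := fun x => ⨅ N, (slowProd R N x)⁻¹
  have hq : ∀ x, 0 < q x := fun x => (inv_pos.2 (Real.exp_pos (2 * x))).trans_le <|
    le_ciInf (ι := ℕ) fun N => inv_anti₀ (hpos N x) (slowProd_le_exp hR2 N x.2)
  have hqle : ∀ N x, q x ≤ (slowProd R N x)⁻¹ := fun N x => ciInf_le (hbd x) N
  have hM0 : 0 ≤ M 0 := le_trans (by positivity) (hM 0 0)
  refine ⟨fun x => ⟨q x, (hq x).le⟩, ⟨M 0 + 2, by linarith⟩, ?_, ?_, hq, ?_, ?_, ?_⟩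
  · change 0 < M 0 + 2
    linarith
  · intro x y hxy
    exact ciInf_mono (hbd y) fun N => inv_anti₀ (hpos N x) (slowProd_mono hR N x.2 hxy)
  · intro x y
    change q x * q y ≤ ⨅ N, (slowProd R N (x + y : ℝ≥0))⁻¹
    refine le_ciInf fun N => ?_
    calc q x * q y ≤ (slowProd R N x)⁻¹ * (slowProd R N y)⁻¹ :=
          mul_le_mul (hqle N x) (hqle N y) (hq y).le (inv_pos.2 (hpos N x)).le
      _ = (slowProd R N x * slowProd R N y)⁻¹ := (mul_inv _ _).symm
      _ ≤ _ := inv_anti₀ (hpos N (x + y)) (slowProd_add_le hR N x.2 y.2)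
  · intro k
    have h0 : 0 ≤ ∏ j ∈ Finset.range k, R j :=
      Finset.prod_nonneg fun j _ => zero_le_one.trans (hR j)
    refine ⟨⟨∏ j ∈ Finset.range k, R j, h0⟩, fun x => ?_⟩
    change (1 + (x : ℝ)) ^ k * q x ≤ ∏ j ∈ Finset.range k, R j
    calc (1 + (x : ℝ)) ^ k * q x
        ≤ ((∏ j ∈ Finset.range k, R j) * slowProd R k x) * (slowProd R k x)⁻¹ :=
          mul_le_mul (pow_le_slowProd hR k x.2) (hqle k x) (hq x).le
            (mul_nonneg h0 (hpos k x).le)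
      _ = _ := mul_inv_cancel_right₀ (hpos k x).ne' _
  · intro r
    -- The `N`-th factor adds at most `M (N + 1) / R N ≤ 2 ^ (-N)`. Starting from `M 0` for the
    -- empty product, the geometric series yields the constant `M 0 + 2`.
    have h1 : ∀ N, slowProd R N r * |f r| ≤ M 0 + 2 - 2 * (1 / 2) ^ N := by
      intro N
      induction N with
      | zero => simpa [slowProd] using hM 0 r
      | succ N ih =>
        have h2 : slowProd R (N + 1) r * |f r| =
            slowProd R N r * |f r| + (slowProd R N r * r * |f r|) / R N := by
          rw [slowProd, Finset.prod_range_succ, ← slowProd]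
          ring
        have h3 : slowProd R N r * r * |f r| ≤ M (N + 1) := by
          refine le_trans ?_ (hM (N + 1) r)
          rw [pow_succ]
          have := slowProd_le_pow hR N (Nat.cast_nonneg r : (0 : ℝ) ≤ r)
          gcongr
          linarith
        have h4 : (slowProd R N r * r * |f r|) / R N ≤ (1 / 2) ^ N := by
          rw [div_le_iff₀ (zero_lt_one.trans_le (hR N)), div_pow, one_pow, one_div,
            ← div_eq_inv_mul, le_div_iff₀ (by positivity)]
          calc _ = 2 ^ N * (slowProd R N r * r * |f r|) := by ring
            _ ≤ 2 ^ N * M (N + 1) := by gcongr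
            _ ≤ R N := hRM N
        rw [h2, pow_succ]
        linarith
    change |f r| ≤ (M 0 + 2) * q (r : ℝ≥0)
    rw [← div_le_iff₀' (by linarith)]
    refine le_ciInf fun N => ?_
    rw [div_le_iff₀ (by linarith), ← div_eq_inv_mul, le_div_iff₀ (hpos N _)]
    have h5 := h1 N
    have h6 : (0 : ℝ) ≤ 2 * (1 / 2) ^ N := by positivity
    rw [NNReal.coe_natCast]
    linarith

end Sequences

/-! ### Sums over the lattice -/

section LatticeSums

variable {Γ : Type*} [MetricSpace Γ] [DecidableEq Γ] [FiniteBalls Γ] {d : ℕ} {C K : ℝ}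

/-- The exterior is cut into shells `r + l < dist x y ≤ r + l + 1`, on which `G` is at most its
value at the inner radius. The right-hand side has the shape of the inner sum of `gF`. -/
theorem PolynomialGrowth.tsum_compl_ball_le (hΓ : PolynomialGrowth Γ d C K) {G : ℝ≥0 → ℝ≥0∞}
    (hG : Antitone G) (x : Γ) (r : ℕ) :
    ∑' y, (if y ∈ ball x (r + 1) then 0 else G (nndist x y)) ≤
      ∑' l : ℕ, ENNReal.ofReal K * ((r + l + 1 : ℕ) : ℝ≥0∞) ^ (d - 1) * G (r + l : ℕ) := by
  have h1 : ∀ y, (if y ∈ ball x (r + 1) then 0 else G (nndist x y)) ≤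
      ∑' l : ℕ, if y ∈ sphere x (r + l + 1 + 1) then G (r + l : ℕ) else 0 := by
    intro y
    split_ifs with hy
    · exact zero_le
    · rw [mem_ball] at hy
      push_cast at hy
      have hd : (r : ℝ) < dist x y := by linarith
      obtain ⟨l, hl⟩ : ∃ l : ℕ, ⌈dist x y⌉₊ = r + l + 1 :=
        ⟨⌈dist x y⌉₊ - (r + 1), by have := Nat.lt_ceil.2 hd; omega⟩
      have hle : dist x y ≤ (r + l + 1 : ℕ) := by rw [← hl]; exact Nat.le_ceil _
      have hlt : ((r + l : ℕ) : ℝ) < dist x y := Nat.lt_ceil.1 (by omega)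
      refine le_trans ?_ (ENNReal.le_tsum l)
      rw [if_pos]
      · refine hG ?_
        rw [← NNReal.coe_le_coe, NNReal.coe_natCast, coe_nndist]
        exact hlt.le
      · rw [sphere, Finset.mem_sdiff, mem_ball, mem_ball, Nat.add_sub_cancel]
        push_cast at hle hlt ⊢
        constructor <;> linarith
  refine (ENNReal.tsum_le_tsum h1).trans ?_
  rw [ENNReal.tsum_comm]
  refine ENNReal.tsum_le_tsum fun l => ?_
  have h2 : ∑' y, (if y ∈ sphere x (r + l + 1 + 1) then G (r + l : ℕ) else 0) =
      (sphere x (r + l + 1 + 1)).card * G (r + l : ℕ) := by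
    rw [tsum_eq_sum (s := sphere x (r + l + 1 + 1)) fun y hy => if_neg hy, Finset.sum_ite_mem,
      Finset.inter_self, Finset.sum_const, nsmul_eq_mul]
  rw [h2]
  gcongr
  have h3 := ENNReal.ofReal_le_ofReal (hΓ.card_sphere_le x (r + l + 1) (by omega))
  rwa [ENNReal.ofReal_natCast, ENNReal.ofReal_mul hΓ.K_pos.le,
    ENNReal.ofReal_pow (Nat.cast_nonneg _), ENNReal.ofReal_natCast] at h3

theorem PolynomialGrowth.tsum_le (hΓ : PolynomialGrowth Γ d C K) {G : ℝ≥0 → ℝ≥0∞}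
    (hG : Antitone G) (x : Γ) :
    ∑' y, G (nndist x y) ≤
      G 0 + ∑' l : ℕ, ENNReal.ofReal K * ((l + 1 : ℕ) : ℝ≥0∞) ^ (d - 1) * G (l : ℕ) := by
  have h1 : ∀ y, G (nndist x y) =
      (if y = x then G 0 else 0) + if y ∈ ball x (0 + 1) then 0 else G (nndist x y) := by
    intro y
    have h2 : y ∈ ball x (0 + 1) ↔ y = x := by
      rw [mem_ball]
      simp only [zero_add, Nat.cast_one, sub_self, dist_le_zero]
      exact eq_comm
    by_cases h : y = x
    · rw [if_pos h, if_pos (h2.2 h), h, nndist_self, add_zero]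
    · rw [if_neg h, if_neg (mt h2.1 h), zero_add]
  rw [tsum_congr h1, ENNReal.tsum_add, tsum_ite_eq]
  have := hΓ.tsum_compl_ball_le hG x 0
  simp only [zero_add] at this ⊢
  gcongr

theorem tsum_inv_sq_ne_top : ∑' l : ℕ, (((((l : ℝ≥0) + 1) ^ 2)⁻¹ : ℝ≥0) : ℝ≥0∞) ≠ ⊤ := by
  rw [ENNReal.tsum_coe_ne_top_iff_summable]
  rw [← NNReal.summable_coe]
  have := (summable_nat_add_iff 1).2 (Real.summable_nat_pow_inv.2 one_lt_two)
  push_cast at this ⊢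
  exact this

/-- The weight `(1 + x) ^ (-(d + 1))`, which is summable over a `d`-dimensional lattice. -/
def weight (d : ℕ) (x : ℝ≥0) : ℝ≥0 := ((1 + x) ^ (d + 1))⁻¹

theorem weight_antitone (d : ℕ) : Antitone (weight d) := fun x y h => by
  unfold weight
  gcongr

theorem weight_pos (d : ℕ) (x : ℝ≥0) : 0 < weight d x := by
  unfold weight
  positivity

/-- The larger of `a` and `b` is at least `c / 2`, so its weight is at most `2 ^ (d + 1)` times that
of `c`. -/
theorem weight_mul_weight_le (d : ℕ) {a b c : ℝ≥0} (h : c ≤ a + b) :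
    weight d a * weight d b ≤ 2 ^ (d + 1) * weight d c * (weight d a + weight d b) := by
  have key : ∀ a b : ℝ≥0, b ≤ a → c ≤ a + b → weight d a ≤ 2 ^ (d + 1) * weight d c := by
    intro a b hba h
    unfold weight
    rw [← div_eq_mul_inv, inv_eq_one_div, div_le_div_iff₀ (by positivity) (by positivity),
      one_mul, ← mul_pow]
    gcongr
    calc 1 + c ≤ 2 + (a + a) := by
          gcongr
          · norm_num
          · exact h.trans (by gcongr)
      _ = 2 * (1 + a) := by ring
  rcases le_total b a with hba | hab
  · calc weight d a * weight d b ≤ 2 ^ (d + 1) * weight d c * weight d b := by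
          gcongr; exact key a b hba h
      _ ≤ _ := by gcongr; exact le_add_self
  · calc weight d a * weight d b = weight d b * weight d a := mul_comm _ _
      _ ≤ 2 ^ (d + 1) * weight d c * weight d a := by
          gcongr; exact key b a hab (by rwa [add_comm])
      _ ≤ _ := by gcongr; exact le_self_add

/-- The sphere factor `(l + 1) ^ (d - 1)` against the exponent `d + 1` leaves `(l + 1) ^ (-2)`. -/
theorem PolynomialGrowth.exists_tsum_weight_le (hd : 1 ≤ d) (hΓ : PolynomialGrowth Γ d C K) :
    ∃ S : ℝ≥0∞, S ≠ ⊤ ∧ ∀ x : Γ, ∑' y, (weight d (nndist x y) : ℝ≥0∞) ≤ S := by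
  refine ⟨_, ?_, fun x => hΓ.tsum_le (G := fun x => (weight d x : ℝ≥0∞))
    (fun a b h => ENNReal.coe_le_coe.2 (weight_antitone d h)) x⟩
  refine ENNReal.add_ne_top.2 ⟨ENNReal.coe_ne_top, ?_⟩
  have h1 : ∀ l : ℕ, ENNReal.ofReal K * ((l + 1 : ℕ) : ℝ≥0∞) ^ (d - 1) * weight d (l : ℕ) =
      ENNReal.ofReal K * ((((l : ℝ≥0) + 1) ^ 2)⁻¹ : ℝ≥0) := by
    intro l
    rw [mul_assoc]
    congr 1
    have h2 : ((l + 1 : ℕ) : ℝ≥0) ^ (d - 1) * weight d l = (((l : ℝ≥0) + 1) ^ 2)⁻¹ := by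
      unfold weight
      obtain ⟨m, rfl⟩ : ∃ m, d = m + 1 := ⟨d - 1, by omega⟩
      have h0 : (1 + (l : ℝ≥0)) ≠ 0 := by positivity
      rw [Nat.add_sub_cancel, Nat.cast_succ, add_comm (l : ℝ≥0) 1, ← div_eq_mul_inv,
        show m + 1 + 1 = m + 2 from rfl, pow_add, div_mul_cancel_left₀ (pow_ne_zero _ h0)]
    rw [← h2]
    push_cast
    rfl
  simp_rw [h1]
  rw [ENNReal.tsum_mul_left]
  exact ENNReal.mul_ne_top ENNReal.ofReal_ne_top tsum_inv_sq_ne_top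

/-- Every rapidly decaying sequence has a rapidly decaying reproducing majorant. -/
theorem PolynomialGrowth.exists_reproducing_majorant (hd : 1 ≤ d)
    (hΓ : PolynomialGrowth Γ d C K) {f : ℕ → ℝ} (hf : IsSchwartzSeq f) :
    ∃ F : ℝ≥0 → ℝ≥0, Antitone F ∧ IsReproducing Γ F ∧
      IsSchwartzSeq (fun r : ℕ => (F (r : ℝ≥0) : ℝ)) ∧ ∀ r : ℕ, |f r| ≤ F r := by
  -- The majorant is taken for `(1 + r) ^ (d + 1) * f r`, so that `weight d` can be put back into
  -- `F` without losing the domination of `f`.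
  obtain ⟨Q, c, hc, hQ, hQ0, hQadd, hQdecay, hfQ⟩ :=
    exists_supermultiplicative_majorant (hf.pow_mul (d + 1))
  obtain ⟨S, hS, hwS⟩ := hΓ.exists_tsum_weight_le hd
  have hw1 : ∀ x, weight d x ≤ 1 := fun x => by
    unfold weight
    exact inv_le_one_of_one_le₀ (one_le_pow₀ le_self_add)
  let F : ℝ≥0 → ℝ≥0 := fun x => c * weight d x * Q x
  have hF0 : ∀ x, 0 < F x := fun x => mul_pos (mul_pos hc (weight_pos d x)) (hQ0 x)
  refine ⟨F, ?_, ⟨?_, ?_⟩, ?_, ?_⟩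
  · intro x y hxy
    exact mul_le_mul' (mul_le_mul' le_rfl (weight_antitone d hxy)) (hQ hxy)
  · refine lt_of_le_of_lt (iSup_le fun x => ?_)
      (ENNReal.mul_lt_top (ENNReal.coe_lt_top (r := c * Q 0)) hS.lt_top)
    refine le_trans ?_ (mul_le_mul_right (hwS x) _)
    rw [← ENNReal.tsum_mul_left]
    refine ENNReal.tsum_le_tsum fun y => ?_
    rw [← ENNReal.coe_mul, ENNReal.coe_le_coe]
    calc c * weight d (nndist x y) * Q (nndist x y) ≤ c * weight d (nndist x y) * Q 0 := by
          gcongr; exact hQ zero_le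
      _ = c * Q 0 * weight d (nndist x y) := by ring
  · refine lt_of_le_of_lt (iSup_le fun x => iSup_le fun y => ?_)
      (ENNReal.mul_lt_top (ENNReal.coe_lt_top (r := c * 2 ^ (d + 1)))
        (ENNReal.add_lt_top.2 ⟨hS.lt_top, hS.lt_top⟩))
    refine le_trans ?_ (mul_le_mul_right (add_le_add (hwS x) (hwS y)) _)
    rw [← ENNReal.tsum_add, ← ENNReal.tsum_mul_left]
    refine ENNReal.tsum_le_tsum fun z => ?_
    rw [nndist_comm y z, ← ENNReal.coe_add, ← ENNReal.coe_mul, ← ENNReal.coe_mul,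
      ← ENNReal.coe_div (hF0 _).ne', ENNReal.coe_le_coe]
    rw [div_le_iff₀ (hF0 _)]
    have h1 := nndist_triangle x z y
    generalize nndist x z = a at *
    generalize nndist z y = b at *
    generalize nndist x y = e at *
    -- The weights supply summability in `z`, while supermultiplicativity and monotonicity of `Q`
    -- supply the denominator: `Q a * Q b ≤ Q (a + b) ≤ Q e`.
    calc F a * F b = c * c * (weight d a * weight d b) * (Q a * Q b) := by simp only [F]; ring
      _ ≤ c * c * (2 ^ (d + 1) * weight d e * (weight d a + weight d b)) * Q e := by
          exact mul_le_mul' (mul_le_mul' le_rfl (weight_mul_weight_le d h1))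
            ((hQadd a b).trans (hQ h1))
      _ = _ := by simp only [F]; ring
  · intro k
    obtain ⟨M, hM⟩ := hQdecay k
    refine ⟨c * M, fun r => ?_⟩
    rw [abs_of_nonneg (NNReal.coe_nonneg _)]
    have h1 : (1 + (r : ℝ≥0)) ^ k * F r ≤ c * M := by
      calc (1 + (r : ℝ≥0)) ^ k * F r = c * ((1 + (r : ℝ≥0)) ^ k * Q r) * weight d r := by
            simp only [F]; ring
        _ ≤ c * M * 1 := by gcongr; exacts [hM r, hw1 r]
        _ = c * M := mul_one _
    exact_mod_cast h1
  · intro r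
    have h1 := hfQ r
    have h0 : (0 : ℝ) < (1 + (r : ℝ)) ^ (d + 1) := by positivity
    rw [abs_mul, abs_of_pos h0, ← le_div_iff₀' h0] at h1
    refine h1.trans (le_of_eq ?_)
    simp only [F, weight]
    push_cast
    rw [div_eq_mul_inv]
    ring

/-- All of `1 + t`, `1 + k`, `1 + l` are at most `1 + t + k + l`. Decay of `F` of order `d - 1 + q +
2 + 2` thus pays for the sphere factor, for the decay in `t`, and for convergence of the sums over
`k` and `l`. -/
theorem exists_pow_mul_gF_le (d : ℕ) {F : ℝ≥0 → ℝ≥0}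
    (hF : IsSchwartzSeq fun r : ℕ => (F (r : ℝ≥0) : ℝ)) (q : ℕ) :
    ∃ M : ℝ≥0, ∀ t : ℕ, gF d F t ≤ ((((1 + (t : ℝ≥0)) ^ q)⁻¹ * M : ℝ≥0) : ℝ≥0∞) := by
  obtain ⟨M, hM⟩ := hF (d - 1 + (q + 2 + 2))
  have hM0 : 0 ≤ M := le_trans (by positivity) (hM 0)
  lift M to ℝ≥0 using hM0
  have hM' : ∀ m : ℕ, (1 + (m : ℝ≥0)) ^ (d - 1 + (q + 2 + 2)) * F m ≤ M := fun m => by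
    have := hM m
    rw [abs_of_nonneg (NNReal.coe_nonneg _)] at this
    exact_mod_cast this
  set S : ℝ≥0∞ := ∑' l : ℕ, (((((l : ℝ≥0) + 1) ^ 2)⁻¹ : ℝ≥0) : ℝ≥0∞) with hSdef
  have hS : S ≠ ⊤ := tsum_inv_sq_ne_top
  refine ⟨M * S.toNNReal * S.toNNReal, fun t => ?_⟩
  have h1 : ∀ k l : ℕ, ((t + k + l + 1 : ℕ) : ℝ≥0) ^ (d - 1) * F ((t + k + l : ℕ) : ℝ≥0) ≤
      ((1 + (t : ℝ≥0)) ^ q)⁻¹ * M * (((k : ℝ≥0) + 1) ^ 2)⁻¹ * (((l : ℝ≥0) + 1) ^ 2)⁻¹ := by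
    intro k l
    have h2 := hM' (t + k + l)
    have hm : ((t + k + l + 1 : ℕ) : ℝ≥0) = 1 + ((t + k + l : ℕ) : ℝ≥0) := by
      push_cast; ring
    rw [hm]
    have e : ((1 + (t : ℝ≥0)) ^ q)⁻¹ * M * (((k : ℝ≥0) + 1) ^ 2)⁻¹ * (((l : ℝ≥0) + 1) ^ 2)⁻¹ =
        M / ((1 + (t : ℝ≥0)) ^ q * ((k : ℝ≥0) + 1) ^ 2 * ((l : ℝ≥0) + 1) ^ 2) := by
      rw [div_eq_mul_inv, mul_inv, mul_inv]; ring
    rw [e, le_div_iff₀ (by positivity)]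
    refine le_trans ?_ h2
    rw [pow_add, pow_add, pow_add]
    have ht : 1 + (t : ℝ≥0) ≤ 1 + ((t + k + l : ℕ) : ℝ≥0) := by
      gcongr; omega
    have hk : (k : ℝ≥0) + 1 ≤ 1 + ((t + k + l : ℕ) : ℝ≥0) := by
      rw [add_comm]; gcongr; omega
    have hl : (l : ℝ≥0) + 1 ≤ 1 + ((t + k + l : ℕ) : ℝ≥0) := by
      rw [add_comm]; gcongr; omega
    calc _ ≤ (1 + ((t + k + l : ℕ) : ℝ≥0)) ^ (d - 1) * F ((t + k + l : ℕ) : ℝ≥0) *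
          ((1 + ((t + k + l : ℕ) : ℝ≥0)) ^ q * (1 + ((t + k + l : ℕ) : ℝ≥0)) ^ 2 *
            (1 + ((t + k + l : ℕ) : ℝ≥0)) ^ 2) := by gcongr
      _ = _ := by ring
  calc gF d F t ≤ ∑' (k : ℕ) (l : ℕ), ((((1 + (t : ℝ≥0)) ^ q)⁻¹ * M : ℝ≥0) : ℝ≥0∞) *
        ((((k : ℝ≥0) + 1) ^ 2)⁻¹ : ℝ≥0) * ((((l : ℝ≥0) + 1) ^ 2)⁻¹ : ℝ≥0) := by
        refine ENNReal.tsum_le_tsum fun k => ENNReal.tsum_le_tsum fun l => ?_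
        exact_mod_cast h1 k l
    _ = ((((1 + (t : ℝ≥0)) ^ q)⁻¹ * M : ℝ≥0) : ℝ≥0∞) * S * S := by
        simp_rw [ENNReal.tsum_mul_left, ENNReal.tsum_mul_right, ENNReal.tsum_mul_left, ← hSdef]
    _ = _ := by
        conv_lhs => rw [← ENNReal.coe_toNNReal hS]
        rw [← ENNReal.coe_mul, ← ENNReal.coe_mul]
        congr 1
        ring

theorem gF_ne_top_of_isSchwartzSeq (d : ℕ) {F : ℝ≥0 → ℝ≥0}
    (hF : IsSchwartzSeq fun r : ℕ => (F (r : ℝ≥0) : ℝ)) (t : ℕ) : gF d F t ≠ ⊤ := by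
  obtain ⟨M, hM⟩ := exists_pow_mul_gF_le d hF 0
  exact ne_top_of_le_ne_top ENNReal.coe_ne_top (hM t)

theorem isSchwartzSeq_gF (d : ℕ) {F : ℝ≥0 → ℝ≥0}
    (hF : IsSchwartzSeq fun r : ℕ => (F (r : ℝ≥0) : ℝ)) :
    IsSchwartzSeq fun t => (gF d F t).toReal := by
  intro q
  obtain ⟨M, hM⟩ := exists_pow_mul_gF_le d hF q
  refine ⟨M, fun t => ?_⟩
  have h1 := ENNReal.toReal_mono ENNReal.coe_ne_top (hM t)
  rw [ENNReal.coe_toReal] at h1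
  push_cast at h1
  rw [abs_of_nonneg ENNReal.toReal_nonneg]
  rwa [← div_eq_inv_mul, le_div_iff₀' (by positivity)] at h1

end LatticeSums

/-! ### Averages over finite groups -/

section GroupAvg

variable {G A : Type*} [Group G] [Fintype G]

/-- The average of `ρ g * X * ρ g⁻¹` over a finite group. -/
def groupAvg [Ring A] [Algebra ℂ A] (ρ : G →* A) (X : A) : A :=
  (Fintype.card G : ℂ)⁻¹ • ∑ g, ρ g * X * ρ g⁻¹

theorem commute_groupAvg [Ring A] [Algebra ℂ A] (ρ : G →* A) (X : A) (h : G) :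
    Commute (groupAvg ρ X) (ρ h) := by
  rw [groupAvg]
  refine Commute.smul_left ?_ _
  rw [Commute, SemiconjBy, Finset.sum_mul, Finset.mul_sum, ← Equiv.sum_comp (Equiv.mulLeft h)]
  refine Finset.sum_congr rfl fun g _ => ?_
  have hh : ρ h⁻¹ * ρ h = 1 := by rw [← map_mul, inv_mul_cancel, map_one]
  simp only [Equiv.coe_mulLeft, map_mul, mul_inv_rev, mul_assoc, hh, mul_one]

theorem commute_groupAvg_of_forall [Ring A] [Algebra ℂ A] (ρ : G →* A) {X Y : A}
    (h : ∀ g, Commute (ρ g * X * ρ g⁻¹) Y) : Commute (groupAvg ρ X) Y :=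
  Commute.smul_left (Commute.sum_left _ _ _ fun g _ => h g) _

theorem groupAvg_mem [Ring A] [Algebra ℂ A] (S : Subalgebra ℂ A) {ρ : G →* A} {X : A}
    (hX : X ∈ S) (hρ : ∀ g, ρ g ∈ S) : groupAvg ρ X ∈ S :=
  S.smul_mem (S.sum_mem fun g _ => S.mul_mem (S.mul_mem (hρ g) hX) (hρ _)) _

theorem groupAvg_sub [Ring A] [Algebra ℂ A] (ρ : G →* A) (X Y : A) :
    groupAvg ρ (X - Y) = groupAvg ρ X - groupAvg ρ Y := by
  simp [groupAvg, mul_sub, sub_mul, Finset.sum_sub_distrib, smul_sub]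

theorem groupAvg_eq_self_sub [Ring A] [Algebra ℂ A] (ρ : G →* A) (X : A) :
    groupAvg ρ X - X = (Fintype.card G : ℂ)⁻¹ • ∑ g, (ρ g * X * ρ g⁻¹ - X) := by
  rw [Finset.sum_sub_distrib, smul_sub, groupAvg, Finset.sum_const, Finset.card_univ,
    ← Nat.cast_smul_eq_nsmul ℂ, inv_smul_smul₀ (by simp)]

theorem norm_card_inv_smul_sum_le [NormedRing A] [NormedAlgebra ℂ A] (f : G → A) {ε : ℝ}
    (hf : ∀ g, ‖f g‖ ≤ ε) : ‖(Fintype.card G : ℂ)⁻¹ • ∑ g, f g‖ ≤ ε := by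
  have h0 : (0 : ℝ) < Fintype.card G := by exact_mod_cast Fintype.card_pos
  have h1 : ‖∑ g, f g‖ ≤ Fintype.card G * ε := by
    simpa using norm_sum_le_of_le Finset.univ fun g _ => hf g
  rw [norm_smul, norm_inv, Complex.norm_natCast, inv_mul_le_iff₀ h0]
  exact h1

theorem norm_groupAvg_le [NormedRing A] [NormedAlgebra ℂ A] {ρ : G →* A} (hρ : ∀ g, ‖ρ g‖ ≤ 1)
    (X : A) : ‖groupAvg ρ X‖ ≤ ‖X‖ := by
  refine norm_card_inv_smul_sum_le _ fun g => ?_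
  calc ‖ρ g * X * ρ g⁻¹‖ ≤ ‖ρ g‖ * ‖X‖ * ‖ρ g⁻¹‖ := norm_mul₃_le
    _ ≤ 1 * ‖X‖ * 1 := by gcongr <;> exact hρ _
    _ = ‖X‖ := by ring

/-- Each term minus `X` is a commutator with `ρ g`, multiplied by a contraction; the average
inherits the bound regardless of the order of the group. -/
theorem norm_groupAvg_sub_le [NormedRing A] [NormedAlgebra ℂ A] {ρ : G →* A}
    (hρ : ∀ g, ‖ρ g‖ ≤ 1) {X : A} {ε : ℝ} (hX : ∀ g, ‖X * ρ g - ρ g * X‖ ≤ ε) :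
    ‖groupAvg ρ X - X‖ ≤ ε := by
  rw [groupAvg_eq_self_sub]
  refine norm_card_inv_smul_sum_le _ fun g => ?_
  have h1 : ρ g * X * ρ g⁻¹ - X = -(X * ρ g - ρ g * X) * ρ g⁻¹ := by
    simp [sub_mul, mul_assoc, ← map_mul]
  rw [h1]
  refine (norm_mul_le _ _).trans ?_
  rw [norm_neg]
  exact (mul_le_of_le_one_right (norm_nonneg _) (hρ _)).trans (hX g)

end GroupAvg

/-! ### Sign and permutation matrices -/

section SignPerm

variable {I : Type*} [Fintype I] [DecidableEq I]

/-- Diagonal matrices of signs. -/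
def signHom (I : Type*) [Fintype I] [DecidableEq I] : (I → ℤˣ) →* Matrix I I ℂ where
  toFun e := Matrix.diagonal fun i => ((e i : ℤ) : ℂ)
  map_one' := by simp
  map_mul' e e' := by simp

theorem star_signHom_mul (e : I → ℤˣ) : star (signHom I e) * signHom I e = 1 := by
  have h : ∀ i, ((e i : ℤ) : ℂ) * ((e i : ℤ) : ℂ) = 1 := fun i => by
    rcases Int.units_eq_one_or (e i) with h | h <;> simp [h]
  simp [signHom, Matrix.star_eq_conjTranspose, Matrix.diagonal_conjTranspose, Pi.star_def, h]

theorem permMatrixHom_apply' (π : Equiv.Perm I) (i j : I) :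
    Matrix.permMatrixHom (R := ℂ) π i j = if i = π j then 1 else 0 := by
  simp [Matrix.permMatrixHom, Equiv.Perm.permMatrix, PEquiv.toMatrix_apply, Equiv.Perm.inv_def,
    Equiv.eq_symm_apply, eq_comm]

theorem star_permMatrixHom_mul (π : Equiv.Perm I) :
    star (Matrix.permMatrixHom (R := ℂ) π) * Matrix.permMatrixHom π = 1 := by
  have : star (Matrix.permMatrixHom (R := ℂ) π) = Matrix.permMatrixHom π⁻¹ := by
    ext i j
    simp [Matrix.star_apply, permMatrixHom_apply', apply_ite, eq_comm]
  rw [this, ← map_mul]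
  simp

/-- Permutations normalise the sign group. This allows averaging over the two groups in succession.
-/
theorem permMatrixHom_mul_signHom (π : Equiv.Perm I) (e : I → ℤˣ) :
    Matrix.permMatrixHom π * signHom I e = signHom I (e ∘ ⇑π⁻¹) * Matrix.permMatrixHom π := by
  ext i j
  simp only [signHom, MonoidHom.coe_mk, OneHom.coe_mk, Matrix.mul_diagonal, Matrix.diagonal_mul,
    permMatrixHom_apply', Function.comp]
  split_ifs with h <;> simp [h]

/-- A subalgebra that contains the sign and permutation matrices contains all matrices. -/
theorem mem_of_signHom_of_permMatrixHom (S : Subalgebra ℂ (Matrix I I ℂ))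
    (h1 : ∀ e, signHom I e ∈ S) (h2 : ∀ π, Matrix.permMatrixHom π ∈ S) (M : Matrix I I ℂ) :
    M ∈ S := by
  have h3 : ∀ a : I, Matrix.single a a (1 : ℂ) ∈ S := fun a => by
    have : Matrix.single a a (1 : ℂ) =
        (2⁻¹ : ℂ) • (1 - signHom I fun i => if i = a then -1 else 1) := by
      ext i j
      by_cases hij : i = j
      · subst hij
        by_cases hi : i = a
        · subst hi
          norm_num [signHom]
        · simp [signHom, hi, Ne.symm hi]
      · have : ¬ (a = i ∧ a = j) := fun h => hij (h.1.symm.trans h.2)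
        simp [signHom, hij, this]
    rw [this]
    exact S.smul_mem (S.sub_mem S.one_mem (h1 _)) _
  have h4 : ∀ a b : I, Matrix.single a b (1 : ℂ) ∈ S := fun a b => by
    have : Matrix.single a b (1 : ℂ) =
        Matrix.single a a 1 * Matrix.permMatrixHom (Equiv.swap a b) := by
      ext i j
      by_cases hi : a = i
      · subst hi
        simp only [Matrix.single_mul_apply_same, one_mul, permMatrixHom_apply',
          Matrix.single_apply, true_and]
        congr 1
        rw [eq_iff_iff, ← Equiv.swap_inv, Equiv.Perm.eq_inv_iff_eq]
        simp
      · simp [hi, Matrix.mul_apply]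
    rw [this]
    exact S.mul_mem (h3 a) (h2 _)
  rw [Matrix.matrix_eq_sum_single M]
  refine S.sum_mem fun i _ => S.sum_mem fun j _ => ?_
  have : Matrix.single i j (M i j) = M i j • Matrix.single i j (1 : ℂ) := by simp
  rw [this]
  exact S.smul_mem (h4 i j) _

end SignPerm

/-! ### Local algebras and their commutants -/

section Commutant

variable {Γ : Type*} [DecidableEq Γ] {n : Γ → ℕ}

theorem localRep_single {Λ : Finset Γ} (a b : LocalConfig n Λ) :
    localRep n Λ (Matrix.single a b 1) = matrixUnit a b := by
  ext ψ σ
  simp only [localRep_apply, matrixUnit_apply, Matrix.single_apply]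
  by_cases h : restrict Λ σ = a
  · simp [h]
  · simp [h, Ne.symm h]

theorem restrict_overwrite_of_disjoint {Λ Θ : Finset Γ} (h : Disjoint Λ Θ) (σ : Config n)
    (b : LocalConfig n Λ) : restrict Θ (overwrite σ b) = restrict Θ σ := by
  funext j
  have : (j : Γ) ∉ Λ := fun hj => Finset.disjoint_left.1 h hj j.2
  simp [restrict, overwrite, this]

theorem overwrite_comm {Λ Θ : Finset Γ} (h : Disjoint Λ Θ) (σ : Config n)
    (b : LocalConfig n Λ) (c : LocalConfig n Θ) :
    overwrite (overwrite σ b) c = overwrite (overwrite σ c) b := by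
  funext j
  by_cases h1 : j ∈ Λ
  · simp [overwrite, h1, Finset.disjoint_left.1 h h1]
  · simp [overwrite, h1]

/-- The algebras of disjoint regions commute. -/
theorem commute_localRep {Λ Θ : Finset Γ} (h : Disjoint Λ Θ)
    (M : Matrix (LocalConfig n Λ) (LocalConfig n Λ) ℂ)
    (N : Matrix (LocalConfig n Θ) (LocalConfig n Θ) ℂ) :
    Commute (localRep n Λ M) (localRep n Θ N) := by
  rw [Commute, SemiconjBy]
  ext ψ σ
  simp only [mul_apply_eq_comp, localRep_apply, Finset.mul_sum, restrict_overwrite_of_disjoint h,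
    restrict_overwrite_of_disjoint h.symm]
  rw [Finset.sum_comm]
  refine Finset.sum_congr rfl fun b _ => Finset.sum_congr rfl fun c _ => ?_
  rw [overwrite_comm h]
  ring

theorem localRep_range_mono {Λ Λ' : Finset Γ} (h : Λ ⊆ Λ') :
    (localRep n Λ).range ≤ (localRep n Λ').range := by
  rintro _ ⟨M, rfl⟩
  exact ⟨extendMatrix h M, localRep_extendMatrix h M⟩

theorem commute_localRep_of_matrixUnit {Λ : Finset Γ} {Y : HilbertSp n →L[ℂ] HilbertSp n}
    (h : ∀ a b : LocalConfig n Λ, Commute Y (matrixUnit a b))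
    (M : Matrix (LocalConfig n Λ) (LocalConfig n Λ) ℂ) : Commute Y (localRep n Λ M) := by
  change Commute Y (localOp M)
  exact Commute.sum_right _ _ _ fun a _ => Commute.sum_right _ _ _ fun b _ =>
    (h a b).smul_right _

theorem restrict_union_eq_iff {Λ Θ : Finset Γ} (σ : Config n) (a : LocalConfig n (Λ ∪ Θ)) :
    restrict (Λ ∪ Θ) σ = a ↔
      restrict Λ σ = (fun j : Λ => a ⟨j, Finset.mem_union_left _ j.2⟩) ∧
      restrict Θ σ = (fun j : Θ => a ⟨j, Finset.mem_union_right _ j.2⟩) := by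
  constructor
  · rintro rfl
    exact ⟨rfl, rfl⟩
  · rintro ⟨h1, h2⟩
    funext ⟨j, hj⟩
    rcases Finset.mem_union.1 hj with hj' | hj'
    · exact congrFun h1 ⟨j, hj'⟩
    · exact congrFun h2 ⟨j, hj'⟩

/-- The tensor factorisation of matrix units reduces commutation with the algebra of a union to
commutation with the two parts. -/
theorem matrixUnit_union {Λ Θ : Finset Γ} (h : Disjoint Λ Θ) (a b : LocalConfig n (Λ ∪ Θ)) :
    matrixUnit a b =
      matrixUnit (fun j : Λ => a ⟨j, Finset.mem_union_left _ j.2⟩)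
        (fun j : Λ => b ⟨j, Finset.mem_union_left _ j.2⟩) *
      matrixUnit (fun j : Θ => a ⟨j, Finset.mem_union_right _ j.2⟩)
        (fun j : Θ => b ⟨j, Finset.mem_union_right _ j.2⟩) := by
  ext ψ σ
  have h1 : overwrite σ b = overwrite (overwrite σ
      (fun j : Λ => b ⟨j, Finset.mem_union_left _ j.2⟩))
      (fun j : Θ => b ⟨j, Finset.mem_union_right _ j.2⟩) := by
    funext j
    by_cases h1 : j ∈ Λ <;> by_cases h2 : j ∈ Θ <;> simp [overwrite, h1, h2]
  simp only [mul_apply_eq_comp, matrixUnit_apply, restrict_union_eq_iff,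
    restrict_overwrite_of_disjoint h, ite_and, h1]

/-- An operator which commutes with the algebras of two disjoint regions commutes with the algebra
of their union. -/
theorem commute_localRep_union {Λ Θ : Finset Γ} (h : Disjoint Λ Θ)
    {Y : HilbertSp n →L[ℂ] HilbertSp n} (h1 : ∀ M, Commute Y (localRep n Λ M))
    (h2 : ∀ M, Commute Y (localRep n Θ M))
    (M : Matrix (LocalConfig n (Λ ∪ Θ)) (LocalConfig n (Λ ∪ Θ)) ℂ) :
    Commute Y (localRep n (Λ ∪ Θ) M) := by
  refine commute_localRep_of_matrixUnit (fun a b => ?_) M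
  rw [matrixUnit_union h, ← localRep_single, ← localRep_single]
  exact (h1 _).mul_right (h2 _)

/-- An operator which commutes with the algebra of `Θ` is determined by one of its blocks. -/
theorem eq_sum_matrixUnit_conj {Θ : Finset Γ} {Y : HilbertSp n →L[ℂ] HilbertSp n}
    (h : ∀ M, Commute Y (localRep n Θ M)) (c₀ : LocalConfig n Θ) :
    Y = ∑ c, matrixUnit c c₀ * Y * matrixUnit c₀ c := by
  have h1 : ∑ c : LocalConfig n Θ, matrixUnit (n := n) c c = 1 := by
    ext ψ σ
    simp only [sum_apply, lp.coeFn_sum, Finset.sum_apply, matrixUnit_apply]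
    simp
  calc Y = ∑ c : LocalConfig n Θ, Y * matrixUnit c c := by
        rw [← Finset.mul_sum, h1, mul_one]
    _ = _ := by
        refine Finset.sum_congr rfl fun c _ => ?_
        have h2 := h (Matrix.single c c₀ 1)
        rw [localRep_single] at h2
        rw [← h2.eq, mul_assoc, matrixUnit_mul, if_pos rfl]

/-- An element of `𝔸(Λ)` which commutes with `𝔸(Θ)` belongs to `𝔸(Λ \ Θ)`. -/
theorem mem_range_sdiff_of_commute [∀ j, NeZero (n j)] {Λ Θ : Finset Γ} (hΘ : Θ ⊆ Λ)
    {Y : HilbertSp n →L[ℂ] HilbertSp n} (hY : Y ∈ (localRep n Λ).range)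
    (h : ∀ M, Commute Y (localRep n Θ M)) : Y ∈ (localRep n (Λ \ Θ)).range := by
  obtain ⟨M, hM⟩ := hY
  replace hM : localRep n Λ M = Y := hM
  let c₀ : LocalConfig n Θ := fun _ => 0
  let ρ : LocalConfig n (Λ \ Θ) → LocalConfig n Λ := fun b =>
    restrict Λ (overwrite (overwrite (fun _ => 0) b) c₀)
  have hρ : ∀ (σ : Config n) b, restrict Λ (overwrite (overwrite σ b) c₀) = ρ b := by
    intro σ b
    funext j
    have := j.2
    by_cases hj : (j : Γ) ∈ Θ <;> simp [ρ, restrict, overwrite, hj]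
  -- Commuting with `𝔸(Θ)` makes `Y` act identically in every block over `Θ`, so the block where
  -- both indices equal `c₀` on `Θ` determines `Y`.
  let N : Matrix (LocalConfig n (Λ \ Θ)) (LocalConfig n (Λ \ Θ)) ℂ := fun a b => M (ρ a) (ρ b)
  refine ⟨N, ?_⟩
  change localRep n (Λ \ Θ) N = Y
  rw [eq_sum_matrixUnit_conj h c₀]
  ext ψ σ
  simp only [sum_apply, lp.coeFn_sum, Finset.sum_apply, mul_apply_eq_comp, matrixUnit_apply,
    Finset.sum_ite_eq, Finset.mem_univ, if_true, localRep_apply, ← hM]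
  have h0 : restrict Λ (overwrite σ c₀) = ρ (restrict (Λ \ Θ) σ) := by
    rw [← hρ σ, overwrite_restrict]
  rw [h0]
  simp only [mul_ite, mul_zero]
  rw [← Finset.sum_filter]
  refine Finset.sum_bij' (fun b _ => ρ b) (fun c _ => fun j => c ⟨j, Finset.sdiff_subset j.2⟩)
    ?_ ?_ ?_ ?_ ?_
  · intro b _
    simp only [Finset.mem_filter, Finset.mem_univ, true_and]
    funext j
    simp [restrict, overwrite, ρ, hΘ j.2]
  · simp
  · intro b _
    funext j
    have := (Finset.mem_sdiff.1 j.2).2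
    simp [ρ, restrict, overwrite, this]
  · intro c hc
    simp only [Finset.mem_filter, Finset.mem_univ, true_and] at hc
    funext j
    by_cases hj : (j : Γ) ∈ Θ
    · have := congrFun hc ⟨j, hj⟩
      simp only [restrict, overwrite, j.2, dif_pos] at this
      simp [ρ, restrict, overwrite, hj, this]
    · simp [ρ, restrict, overwrite, hj]
  · intro b _
    have h5 : overwrite (overwrite (overwrite σ c₀) (ρ b)) (restrict Θ σ) = overwrite σ b := by
      funext j
      by_cases hj : j ∈ Θ
      · simp [restrict, overwrite, hj]
      · by_cases hj' : j ∈ Λ <;> simp [ρ, restrict, overwrite, hj, hj']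
    rw [h5]

end Commutant

/-! ### The twirl over a finite region -/

section Twirl

variable {Γ : Type*} [DecidableEq Γ] {n : Γ → ℕ}

theorem norm_le_one_of_star_mul_self_eq_one {A : Type*} [NormedRing A] [StarRing A] [CStarRing A]
    [NormOneClass A] {u : A} (hu : star u * u = 1) : ‖u‖ ≤ 1 := by
  have h := CStarRing.norm_star_mul_self (x := u)
  rw [hu, norm_one] at h
  nlinarith [norm_nonneg u]

instance [∀ j, NeZero (n j)] : Nontrivial (HilbertSp n →L[ℂ] HilbertSp n) := by
  classical
  refine ⟨1, 0, fun h => ?_⟩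
  have h1 := congrArg (fun T : HilbertSp n →L[ℂ] HilbertSp n =>
    T (lp.single 2 (fun _ => 0) (1 : ℂ)) (fun _ => 0)) h
  simp at h1

theorem norm_localRep_le_one [∀ j, NeZero (n j)] {Λ : Finset Γ}
    {M : Matrix (LocalConfig n Λ) (LocalConfig n Λ) ℂ} (hM : star M * M = 1) :
    ‖localRep n Λ M‖ ≤ 1 :=
  norm_le_one_of_star_mul_self_eq_one (by rw [← map_star, ← map_mul, hM, map_one])

/-- The sign matrices of the region `Λ`. -/
def signRep (n : Γ → ℕ) (Λ : Finset Γ) :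
    (LocalConfig n Λ → ℤˣ) →* (HilbertSp n →L[ℂ] HilbertSp n) :=
  ((localRep n Λ).toAlgHom : _ →* _).comp (signHom _)

/-- The permutation matrices of the region `Λ`. -/
def permRep (n : Γ → ℕ) (Λ : Finset Γ) :
    Equiv.Perm (LocalConfig n Λ) →* (HilbertSp n →L[ℂ] HilbertSp n) :=
  ((localRep n Λ).toAlgHom : _ →* _).comp (Matrix.permMatrixHom (R := ℂ))

/-- A projection onto the commutant of `𝔸(Λ)`. -/
def twirl (Λ : Finset Γ) (X : HilbertSp n →L[ℂ] HilbertSp n) : HilbertSp n →L[ℂ] HilbertSp n :=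
  groupAvg (permRep n Λ) (groupAvg (signRep n Λ) X)

theorem signRep_apply (Λ : Finset Γ) (e) : signRep n Λ e = localRep n Λ (signHom _ e) := rfl

theorem permRep_apply (Λ : Finset Γ) (π) :
    permRep n Λ π = localRep n Λ (Matrix.permMatrixHom π) := rfl

/-- The inner average commutes with signs and the outer one with permutations; the outer average
does not spoil the former property, since permutations normalise the signs. Together the two groups
generate the matrix algebra. -/
theorem commute_twirl (Λ : Finset Γ) (X : HilbertSp n →L[ℂ] HilbertSp n)
    (M : Matrix (LocalConfig n Λ) (LocalConfig n Λ) ℂ) :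
    Commute (twirl Λ X) (localRep n Λ M) := by
  have key := mem_of_signHom_of_permMatrixHom
    ((Subalgebra.centralizer ℂ {twirl Λ X}).comap (localRep n Λ).toAlgHom) ?_ ?_ M
  · rw [Subalgebra.mem_comap, Subalgebra.mem_centralizer_iff] at key
    exact key _ rfl
  · intro e
    rw [Subalgebra.mem_comap, Subalgebra.mem_centralizer_iff]
    rintro _ rfl
    refine Commute.eq (commute_groupAvg_of_forall _ fun π => ?_)
    have h1 := commute_groupAvg (signRep n Λ) X (e ∘ ⇑π)
    have h2 : permRep n Λ π * signRep n Λ (e ∘ ⇑π) = signRep n Λ e * permRep n Λ π := by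
      rw [permRep_apply, signRep_apply, signRep_apply, ← map_mul, ← map_mul,
        permMatrixHom_mul_signHom]
      congr 3
      funext i
      simp
    have h3 : permRep n Λ π⁻¹ * permRep n Λ π = 1 := by
      rw [← map_mul, inv_mul_cancel, map_one]
    have h3' : permRep n Λ π * permRep n Λ π⁻¹ = 1 := by
      rw [← map_mul, mul_inv_cancel, map_one]
    have h4 : permRep n Λ π⁻¹ * signRep n Λ e = signRep n Λ (e ∘ ⇑π) * permRep n Λ π⁻¹ := by
      calc permRep n Λ π⁻¹ * signRep n Λ e
          = permRep n Λ π⁻¹ * (signRep n Λ e * permRep n Λ π) * permRep n Λ π⁻¹ := by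
            simp only [mul_assoc, h3', mul_one]
        _ = _ := by rw [← h2, ← mul_assoc, h3, one_mul]
    change Commute _ (signRep n Λ e)
    rw [Commute, SemiconjBy]
    calc permRep n Λ π * groupAvg (signRep n Λ) X * permRep n Λ π⁻¹ * signRep n Λ e
        = permRep n Λ π * (groupAvg (signRep n Λ) X * signRep n Λ (e ∘ ⇑π)) *
            permRep n Λ π⁻¹ := by simp only [mul_assoc, h4]
      _ = permRep n Λ π * signRep n Λ (e ∘ ⇑π) * groupAvg (signRep n Λ) X *
            permRep n Λ π⁻¹ := by rw [h1.eq]; simp only [mul_assoc]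
      _ = _ := by rw [h2]; simp only [mul_assoc]
  · intro π
    rw [Subalgebra.mem_comap, Subalgebra.mem_centralizer_iff]
    rintro _ rfl
    exact (commute_groupAvg (permRep n Λ) _ π).eq

theorem norm_signRep_le [∀ j, NeZero (n j)] (Λ : Finset Γ) (e) : ‖signRep n Λ e‖ ≤ 1 :=
  norm_localRep_le_one (star_signHom_mul e)

theorem norm_permRep_le [∀ j, NeZero (n j)] (Λ : Finset Γ) (π) : ‖permRep n Λ π‖ ≤ 1 :=
  norm_localRep_le_one (star_permMatrixHom_mul π)

theorem norm_twirl_le [∀ j, NeZero (n j)] (Λ : Finset Γ) (X : HilbertSp n →L[ℂ] HilbertSp n) :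
    ‖twirl Λ X‖ ≤ ‖X‖ :=
  (norm_groupAvg_le (norm_permRep_le Λ) _).trans (norm_groupAvg_le (norm_signRep_le Λ) _)

theorem twirl_sub (Λ : Finset Γ) (X Y : HilbertSp n →L[ℂ] HilbertSp n) :
    twirl Λ (X - Y) = twirl Λ X - twirl Λ Y := by
  simp only [twirl, groupAvg_sub]

theorem twirl_mem {Λ : Finset Γ} (S : Subalgebra ℂ (HilbertSp n →L[ℂ] HilbertSp n))
    {X : HilbertSp n →L[ℂ] HilbertSp n} (hX : X ∈ S) (h : ∀ M, localRep n Λ M ∈ S) :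
    twirl Λ X ∈ S :=
  groupAvg_mem S (groupAvg_mem S hX fun _ => h _) fun _ => h _

/-- The factor `2` counts the two averages. No dimension of the region enters, which is essential
for the later uniform bounds. -/
theorem norm_twirl_sub_le [∀ j, NeZero (n j)] {Λ : Finset Γ} {X : HilbertSp n →L[ℂ] HilbertSp n}
    {ε : ℝ} (hX : ∀ M, ‖localRep n Λ M‖ ≤ 1 → ‖X * localRep n Λ M - localRep n Λ M * X‖ ≤ ε) :
    ‖twirl Λ X - X‖ ≤ 2 * ε := by
  have h1 : ‖groupAvg (permRep n Λ) X - X‖ ≤ ε :=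
    norm_groupAvg_sub_le (norm_permRep_le Λ) fun π => hX _ (norm_permRep_le Λ π)
  have h2 : ‖groupAvg (signRep n Λ) X - X‖ ≤ ε :=
    norm_groupAvg_sub_le (norm_signRep_le Λ) fun e => hX _ (norm_signRep_le Λ e)
  have h3 : twirl Λ X - X = groupAvg (permRep n Λ) (groupAvg (signRep n Λ) X - X) +
      (groupAvg (permRep n Λ) X - X) := by
    rw [groupAvg_sub, twirl]
    abel
  rw [h3]
  have h4 := norm_add_le_of_le ((norm_groupAvg_le (norm_permRep_le Λ) _).trans h2) h1
  linarith

/-- An operator which almost commutes with each site of `Θ` is close to an operator which commutes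
with the algebra of `Θ`. -/
theorem exists_commute_of_sites [∀ j, NeZero (n j)] (X : HilbertSp n →L[ℂ] HilbertSp n)
    (ε : Γ → ℝ) (Θ : Finset Γ)
    (hX : ∀ j ∈ Θ, ∀ M, ‖localRep n {j} M‖ ≤ 1 →
      ‖X * localRep n {j} M - localRep n {j} M * X‖ ≤ ε j) :
    ∃ Y, (∀ M, Commute Y (localRep n Θ M)) ∧ ‖Y - X‖ ≤ 2 * ∑ j ∈ Θ, ε j := by
  induction Θ using Finset.induction_on with
  | empty =>
    refine ⟨X, fun M => commute_localRep_of_matrixUnit (fun a b => ?_) M, by simp⟩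
    -- The empty region has a single configuration, so its algebra consists of scalars.
    have : matrixUnit (n := n) a b = 1 := by
      ext ψ σ
      have h1 : restrict ∅ σ = a := Subsingleton.elim _ _
      have h2 : overwrite σ b = σ := overwrite_eq_self (Subsingleton.elim _ _)
      simp [h1, h2]
    rw [this]
    exact Commute.one_right X
  | insert j Θ hj ih =>
    obtain ⟨Y, hY, hYX⟩ := ih fun i hi => hX i (Finset.mem_insert_of_mem hi)
    have hd : Disjoint {j} Θ := Finset.disjoint_singleton_left.2 hj
    refine ⟨twirl {j} Y, ?_, ?_⟩
    · rw [Finset.insert_eq]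
      refine commute_localRep_union hd (commute_twirl {j} Y) fun M => ?_
      have h1 := twirl_mem (Λ := {j}) (X := Y) (Subalgebra.centralizer ℂ {localRep n Θ M}) ?_ ?_
      · exact ((Subalgebra.mem_centralizer_iff _).1 h1 _ rfl).symm
      · rw [Subalgebra.mem_centralizer_iff]
        rintro _ rfl
        exact (hY M).eq.symm
      · intro N
        rw [Subalgebra.mem_centralizer_iff]
        rintro _ rfl
        exact (commute_localRep hd N M).eq.symm
    · have h1 : twirl {j} Y - X = twirl {j} (Y - X) + (twirl {j} X - X) := by
        rw [twirl_sub]; abel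
      rw [h1, Finset.sum_insert hj]
      have h2 := norm_add_le_of_le ((norm_twirl_le {j} _).trans hYX)
        (norm_twirl_sub_le (hX j (Finset.mem_insert_self _ _)))
      linarith

theorem norm_commutator_le {A : Type*} [NormedRing A] (X Y : A) :
    ‖X * Y - Y * X‖ ≤ 2 * ‖X‖ * ‖Y‖ := by
  have := norm_sub_le_of_le (norm_mul_le X Y) (norm_mul_le Y X)
  linarith

/-- Commutators with a local operator are controlled by commutators with one-site operators. -/
theorem norm_commutator_le_sum_sites [∀ j, NeZero (n j)] {X : HilbertSp n →L[ℂ] HilbertSp n}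
    {ε : Γ → ℝ} {Θ : Finset Γ}
    (hX : ∀ j ∈ Θ, ∀ M, ‖localRep n {j} M‖ ≤ 1 →
      ‖X * localRep n {j} M - localRep n {j} M * X‖ ≤ ε j)
    (M : Matrix (LocalConfig n Θ) (LocalConfig n Θ) ℂ) :
    ‖X * localRep n Θ M - localRep n Θ M * X‖ ≤ 4 * ‖localRep n Θ M‖ * ∑ j ∈ Θ, ε j := by
  obtain ⟨Y, hY, hYX⟩ := exists_commute_of_sites X ε Θ hX
  have h1 : X * localRep n Θ M - localRep n Θ M * X =
      localRep n Θ M * (Y - X) - (Y - X) * localRep n Θ M := by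
    rw [mul_sub, sub_mul, (hY M).eq]; abel
  rw [h1]
  refine (norm_commutator_le _ _).trans ?_
  have := mul_le_mul_of_nonneg_left hYX (norm_nonneg (localRep n Θ M))
  linarith

end Twirl

/-! ### Commutators and approximation in the quasi-local algebra -/

section Observables

variable {Γ : Type*} [DecidableEq Γ] {n : Γ → ℕ}

/-- Closedness provides completeness, hence a C⋆-algebra in which automorphisms are isometric. -/
instance isClosed_quasiLocal (n : Γ → ℕ) :
    IsClosed (quasiLocal n : Set (HilbertSp n →L[ℂ] HilbertSp n)) :=
  StarSubalgebra.isClosed_topologicalClosure _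

theorem norm_starAlgEquiv (α : quasiLocal n ≃⋆ₐ[ℂ] quasiLocal n) (A : quasiLocal n) :
    ‖α A‖ = ‖A‖ :=
  NonUnitalStarAlgHom.norm_map α α.injective A

/-- Passing to `α.symm` exchanges the roles of the two observables, so the reduction to sites can be
applied to either of them. -/
theorem norm_commutator_symm (α : quasiLocal n ≃⋆ₐ[ℂ] quasiLocal n) (A B : quasiLocal n) :
    ‖α.symm A * B - B * α.symm A‖ = ‖α B * A - A * α B‖ := by
  rw [← norm_starAlgEquiv α, map_sub, map_mul, map_mul, StarAlgEquiv.apply_symm_apply, norm_sub_rev]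

theorem mem_localAlg_iff {Λ : Finset Γ} {A : quasiLocal n} :
    A ∈ localAlg n Λ ↔ ∃ M, localRep n Λ M = A := Iff.rfl

theorem commute_of_mem_localAlg {Λ Θ : Finset Γ} (h : Disjoint Λ Θ) {A B : quasiLocal n}
    (hA : A ∈ localAlg n Λ) (hB : B ∈ localAlg n Θ) : A * B = B * A := by
  obtain ⟨M, hM⟩ := mem_localAlg_iff.1 hA
  obtain ⟨N, hN⟩ := mem_localAlg_iff.1 hB
  refine Subtype.ext ?_
  change (A : HilbertSp n →L[ℂ] HilbertSp n) * B = B * A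
  rw [← hM, ← hN]
  exact commute_localRep h M N

/-- Commutators with a local observable are controlled by commutators with one-site observables. -/
theorem norm_commutator_localAlg_le [∀ j, NeZero (n j)] {X B : quasiLocal n} {Θ : Finset Γ}
    (hB : B ∈ localAlg n Θ) {ε : Γ → ℝ}
    (hX : ∀ j ∈ Θ, ∀ V ∈ localAlg n {j}, ‖V‖ ≤ 1 → ‖X * V - V * X‖ ≤ ε j) :
    ‖X * B - B * X‖ ≤ 4 * ‖B‖ * ∑ j ∈ Θ, ε j := by
  obtain ⟨N, hN⟩ := mem_localAlg_iff.1 hB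
  have h1 := norm_commutator_le_sum_sites (X := (X : HilbertSp n →L[ℂ] HilbertSp n)) (ε := ε)
    (Θ := Θ) (fun j hj M hM => hX j hj ⟨_, localRep_mem_quasiLocal {j} M⟩ ⟨M, rfl⟩ hM) N
  rw [hN] at h1
  exact h1

/-- One-site commutator bounds imply the Lieb–Robinson bound. -/
theorem norm_commutator_le_of_sites [∀ j, NeZero (n j)] {α : quasiLocal n ≃⋆ₐ[ℂ] quasiLocal n}
    {g : Γ → Γ → ℝ}
    (hg : ∀ (i j : Γ) (A B : quasiLocal n), A ∈ localAlg n {i} → B ∈ localAlg n {j} →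
      ‖A‖ ≤ 1 → ‖B‖ ≤ 1 → ‖α A * B - B * α A‖ ≤ g i j)
    {Λ Θ : Finset Γ} {A B : quasiLocal n} (hA : A ∈ localAlg n Λ) (hB : B ∈ localAlg n Θ) :
    ‖α A * B - B * α A‖ ≤ 16 * (‖A‖ * ‖B‖ * ∑ i ∈ Λ, ∑ j ∈ Θ, g i j) := by
  -- The second observable is reduced to sites for `α`, then the first for `α.symm`; each reduction
  -- costs a factor `4`.
  refine (norm_commutator_localAlg_le hB (ε := fun j => 4 * ‖A‖ * ∑ i ∈ Λ, g i j)
    fun j _ V hV hV1 => ?_).trans (le_of_eq ?_)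
  · rw [← norm_commutator_symm]
    refine norm_commutator_localAlg_le hA fun i _ U hU hU1 => ?_
    rw [norm_commutator_symm]
    exact hg i j U V hU hV hU1 hV1
  · rw [← Finset.mul_sum, Finset.sum_comm]
    ring

theorem exists_localRep_near {X : HilbertSp n →L[ℂ] HilbertSp n} (hX : X ∈ quasiLocal n) {δ : ℝ}
    (hδ : 0 < δ) : ∃ (Λ : Finset Γ) (M : _), ‖localRep n Λ M - X‖ < δ := by
  have hX' : X ∈ closure ((⨆ Λ : Finset Γ, (localRep n Λ).range :
      StarSubalgebra ℂ (HilbertSp n →L[ℂ] HilbertSp n)) : Set _) := hX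
  obtain ⟨Y, hY, hXY⟩ := Metric.mem_closure_iff.1 hX' δ hδ
  have hdir : Directed (· ≤ ·) fun Λ : Finset Γ => (localRep n Λ).range := fun Λ Θ =>
    ⟨Λ ∪ Θ, localRep_range_mono Finset.subset_union_left,
      localRep_range_mono Finset.subset_union_right⟩
  rw [StarSubalgebra.coe_iSup_of_directed hdir] at hY
  obtain ⟨Λ, M, hM⟩ := Set.mem_iUnion.1 hY
  refine ⟨Λ, M, ?_⟩
  rw [dist_eq_norm, norm_sub_rev, ← hM] at hXY
  exact hXY

/-- An observable which almost commutes with all local observables outside of `Λ₀` is close to the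
algebra of `Λ₀`. -/
theorem iInf_norm_sub_le_of_commutator_le [∀ j, NeZero (n j)] {X : quasiLocal n} {Λ₀ : Finset Γ}
    {ε : ℝ}
    (hX : ∀ Θ : Finset Γ, Disjoint Λ₀ Θ → ∀ B ∈ localAlg n Θ, ‖B‖ ≤ 1 → ‖X * B - B * X‖ ≤ ε) :
    ⨅ B : localAlg n Λ₀, ‖X - B‖ ≤ 2 * ε := by
  refine le_of_forall_pos_le_add fun δ hδ => ?_
  -- The twirl needs a finite region, so `X` is first replaced by a local `Y`. The total error is `2
  -- * (ε + 2 * (δ / 5)) + δ / 5 = 2 * ε + δ`.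
  obtain ⟨Λ, M, hM⟩ := exists_localRep_near X.2 (δ := δ / 5) (by positivity)
  set Y := localRep n Λ M with hY
  let Θ := (Λ ∪ Λ₀) \ Λ₀
  have hΘ : Disjoint Λ₀ Θ := Finset.disjoint_sdiff
  have hYmem : Y ∈ (localRep n (Λ ∪ Λ₀)).range :=
    localRep_range_mono Finset.subset_union_left ⟨M, rfl⟩
  have hZ1 : twirl Θ Y ∈ (localRep n (Λ ∪ Λ₀)).range :=
    twirl_mem (localRep n (Λ ∪ Λ₀)).range.toSubalgebra hYmem fun N =>
      localRep_range_mono Finset.sdiff_subset ⟨N, rfl⟩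
  have hZ2 : twirl Θ Y ∈ (localRep n Λ₀).range := by
    refine localRep_range_mono ?_
      (mem_range_sdiff_of_commute Finset.sdiff_subset hZ1 (commute_twirl Θ Y))
    intro j
    simp only [Finset.mem_sdiff, Finset.mem_union]
    tauto
  obtain ⟨N, hN⟩ := hZ2
  replace hN : localRep n Λ₀ N = twirl Θ Y := hN
  have hZY : ‖twirl Θ Y - Y‖ ≤ 2 * (ε + 2 * (δ / 5)) := by
    refine norm_twirl_sub_le fun V hV => ?_
    have h1 : ‖(X : HilbertSp n →L[ℂ] HilbertSp n) * localRep n Θ V - localRep n Θ V * X‖ ≤ ε :=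
      hX Θ hΘ ⟨_, localRep_mem_quasiLocal Θ V⟩ ⟨V, rfl⟩ hV
    have h2 : Y * localRep n Θ V - localRep n Θ V * Y =
        ((X : HilbertSp n →L[ℂ] HilbertSp n) * localRep n Θ V - localRep n Θ V * X) +
        ((Y - X) * localRep n Θ V - localRep n Θ V * (Y - X)) := by
      rw [sub_mul, mul_sub]; abel
    rw [h2]
    refine norm_add_le_of_le h1 ((norm_commutator_le _ _).trans ?_)
    calc 2 * ‖Y - X‖ * ‖localRep n Θ V‖ ≤ 2 * (δ / 5) * 1 := by gcongr
      _ = 2 * (δ / 5) := mul_one _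
  refine (ciInf_le ⟨0, by rintro _ ⟨B, rfl⟩; exact norm_nonneg _⟩
    (⟨⟨_, localRep_mem_quasiLocal Λ₀ N⟩, ⟨N, rfl⟩⟩ : localAlg n Λ₀)).trans ?_
  change ‖(X : HilbertSp n →L[ℂ] HilbertSp n) - localRep n Λ₀ N‖ ≤ _
  rw [hN, norm_sub_rev]
  have h3 : twirl Θ Y - (X : HilbertSp n →L[ℂ] HilbertSp n) = (twirl Θ Y - Y) + (Y - X) := by abel
  rw [h3]
  have := norm_add_le_of_le hZY hM.le
  linarith

end Observables

/-! ### Almost locality preserving automorphisms are of Lieb–Robinson type -/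

section Automorphisms

theorem ball_one {Γ : Type*} [MetricSpace Γ] [FiniteBalls Γ] (i : Γ) : ball i 1 = {i} := by
  ext j
  simp [mem_ball, eq_comm]

variable {Γ : Type*} [MetricSpace Γ] [DecidableEq Γ] [FiniteBalls Γ] {n : Γ → ℕ}

/-- Real suprema need boundedness: the choice `B = 0` bounds every infimum by `‖α A‖ = 1`. -/
theorem iInf_le_tailH (α : quasiLocal n ≃⋆ₐ[ℂ] quasiLocal n) {s r : ℕ} (hr : r ≠ 0) (p : Γ)
    {A : quasiLocal n} (hA : A ∈ localAlg n (ball p s)) (hA1 : ‖A‖ = 1) :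
    ⨅ B : localAlg n (ball p (s + r)), ‖α A - B‖ ≤ tailH α s r := by
  have h1 : ∀ (p : Γ) (A : {A : quasiLocal n // A ∈ localAlg n (ball p s) ∧ ‖A‖ = 1}),
      ⨅ B : localAlg n (ball p (s + r)), ‖α A - B‖ ≤ 1 := fun p A =>
    (ciInf_le ⟨0, by rintro _ ⟨B, rfl⟩; exact norm_nonneg _⟩ 0).trans (by
      rw [ZeroMemClass.coe_zero, sub_zero, norm_starAlgEquiv, A.2.2])
  rw [tailH, if_neg hr]
  refine le_trans ?_ (le_ciSup ⟨1, ?_⟩ p)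
  · exact le_ciSup (f := fun A : {A : quasiLocal n // A ∈ localAlg n (ball p s) ∧ ‖A‖ = 1} =>
      ⨅ B : localAlg n (ball p (s + r)), ‖α A - B‖)
      ⟨1, by rintro _ ⟨B, rfl⟩; exact h1 p B⟩ ⟨A, hA, hA1⟩
  · rintro _ ⟨q, rfl⟩
    exact Real.iSup_le (h1 q) zero_le_one

theorem tailH_nonneg (α : quasiLocal n ≃⋆ₐ[ℂ] quasiLocal n) (s r : ℕ) : 0 ≤ tailH α s r := by
  rw [tailH]
  split_ifs
  · exact zero_le_one
  · exact Real.iSup_nonneg fun p => Real.iSup_nonneg fun A => Real.iInf_nonneg fun B =>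
      norm_nonneg _

theorem norm_commutator_le_tailH_of_norm_eq_one (α : quasiLocal n ≃⋆ₐ[ℂ] quasiLocal n) {s r : ℕ}
    {p : Γ} {A B : quasiLocal n} {Θ : Finset Γ} (hA : A ∈ localAlg n (ball p s))
    (hA1 : ‖A‖ = 1) (hB : B ∈ localAlg n Θ) (hΘ : Disjoint (ball p (s + r)) Θ) :
    ‖α A * B - B * α A‖ ≤ 2 * tailH α s r * ‖B‖ := by
  -- At `r = 0` the convention `tailH α s 0 = 1` makes the claim the trivial commutator bound.
  rcases eq_or_ne r 0 with rfl | hr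
  · rw [tailH, if_pos rfl]
    have h1 := norm_commutator_le (α A) B
    rwa [norm_starAlgEquiv, hA1] at h1
  · have key : ∀ δ > 0, ‖α A * B - B * α A‖ ≤ 2 * (tailH α s r + δ) * ‖B‖ := by
      intro δ hδ
      have : Nonempty (localAlg n (ball p (s + r))) := ⟨0⟩
      obtain ⟨⟨D, hD⟩, hAD⟩ := exists_lt_of_ciInf_lt
        ((iInf_le_tailH α hr p hA hA1).trans_lt (lt_add_of_pos_right _ hδ))
      have h1 : α A * B - B * α A = (α A - D) * B - B * (α A - D) := by
        rw [sub_mul, mul_sub, commute_of_mem_localAlg hΘ hD hB]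
        abel
      rw [h1]
      refine (norm_commutator_le _ _).trans ?_
      have : ‖α A - D‖ ≤ tailH α s r + δ := hAD.le
      gcongr
    have hcont : Filter.Tendsto (fun δ : ℝ => 2 * (tailH α s r + δ) * ‖B‖)
        (nhdsWithin 0 (Set.Ioi 0)) (nhds (2 * (tailH α s r + 0) * ‖B‖)) :=
      (Continuous.tendsto (by fun_prop) 0).mono_left nhdsWithin_le_nhds
    rw [add_zero] at hcont
    exact ge_of_tendsto hcont (Filter.eventually_of_mem self_mem_nhdsWithin key)

theorem norm_commutator_le_tailH (α : quasiLocal n ≃⋆ₐ[ℂ] quasiLocal n) {s r : ℕ}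
    {p : Γ} {A B : quasiLocal n} {Θ : Finset Γ} (hA : A ∈ localAlg n (ball p s))
    (hB : B ∈ localAlg n Θ) (hΘ : Disjoint (ball p (s + r)) Θ) :
    ‖α A * B - B * α A‖ ≤ 2 * tailH α s r * ‖A‖ * ‖B‖ := by
  rcases eq_or_ne A 0 with rfl | hA0
  · simp
  · have hn : ‖A‖ ≠ 0 := norm_ne_zero_iff.2 hA0
    have hn' : (‖A‖ : ℂ) ≠ 0 := by exact_mod_cast hn
    have h1 := norm_commutator_le_tailH_of_norm_eq_one α (r := r)
      ((localAlg n (ball p s)).smul_mem hA (‖A‖ : ℂ)⁻¹)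
      (by rw [norm_smul, norm_inv, Complex.norm_real, norm_norm, inv_mul_cancel₀ hn]) hB hΘ
    have h2 : A = (‖A‖ : ℂ) • ((‖A‖ : ℂ)⁻¹ • A) := by rw [smul_inv_smul₀ hn']
    have h3 : α A * B - B * α A =
        (‖A‖ : ℂ) • (α ((‖A‖ : ℂ)⁻¹ • A) * B - B * α ((‖A‖ : ℂ)⁻¹ • A)) := by
      rw [smul_sub, ← smul_mul_assoc, ← mul_smul_comm, ← map_smul, ← h2]
    rw [h3, norm_smul, Complex.norm_real, norm_norm]
    calc _ ≤ ‖A‖ * (2 * tailH α s r * ‖B‖) := by gcongr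
      _ = _ := by ring

/-- Only the tail with `s = 1` enters: one-site bounds already give the estimate for all regions. -/
theorem IsALP.exists_isLRFunction {d : ℕ} (hd : 1 ≤ d) {C K : ℝ} (hΓ : PolynomialGrowth Γ d C K)
    [∀ j, NeZero (n j)] {α : quasiLocal n ≃⋆ₐ[ℂ] quasiLocal n} (hα : IsALP d α) :
    ∃ F : ℝ≥0 → ℝ≥0, IsLRFunction d K α F ∧ IsSchwartzSeq fun r : ℕ => (F (r : ℝ≥0) : ℝ) := by
  obtain ⟨f, hf, hαf⟩ := hα
  obtain ⟨F, hF, hFr, hFs, hfF⟩ :=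
    -- The constant `32` is `2` from the commutator bound times `16` from the reduction to sites.
    -- The sequence is shifted by one because sites with `r < dist i j ≤ r + 1` are controlled by `f
    -- r`; the prepended term handles `i = j`.
    hΓ.exists_reproducing_majorant hd ((hf.const_mul 32).cons 32)
  refine ⟨F, ⟨hF, hFr, ?_, gF_ne_top_of_isSchwartzSeq d hFs, (isSchwartzSeq_gF d hFs).const_mul _⟩,
    hFs⟩
  intro Λ Θ A B hA hB
  refine (norm_commutator_le_of_sites (g := fun i j => F (nndist i j) / 16) ?_ hA hB).trans
    (le_of_eq ?_)
  · intro i j A B hA hB hA1 hB1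
    rcases eq_or_ne i j with rfl | hij
    · rw [nndist_self]
      have h1 : |(32 : ℝ)| ≤ F (0 : ℕ) := hfF 0
      have h2 : ‖α A * B - B * α A‖ ≤ 2 * ‖A‖ * ‖B‖ := by
        simpa only [norm_starAlgEquiv] using norm_commutator_le (α A) B
      have h3 : ‖A‖ * ‖B‖ ≤ 1 := mul_le_one₀ hA1 (norm_nonneg _) hB1
      rw [Nat.cast_zero, abs_of_pos (by norm_num)] at h1
      linarith
    · obtain ⟨r, hr⟩ : ∃ r : ℕ, ⌈dist i j⌉₊ = r + 1 :=
        Nat.exists_eq_succ_of_ne_zero (Nat.ceil_pos.2 (dist_pos.2 hij)).ne'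
      have hlt : (r : ℝ) < dist i j := Nat.lt_ceil.1 (by omega)
      have hle : dist i j ≤ (r + 1 : ℕ) := by rw [← hr]; exact Nat.le_ceil _
      have hdis : Disjoint (ball i (1 + r)) {j} := by
        rw [Finset.disjoint_singleton_right, mem_ball]
        push_cast
        linarith
      have h1 : |32 * f r| ≤ F (r + 1 : ℕ) := hfF (r + 1)
      have h2 : F (r + 1 : ℕ) ≤ F (nndist i j) := hF (by
        rw [← NNReal.coe_le_coe, NNReal.coe_natCast, coe_nndist]
        exact hle)
      have h2' : (F (r + 1 : ℕ) : ℝ) ≤ F (nndist i j) := NNReal.coe_le_coe.2 h2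
      have h3 := norm_commutator_le_tailH α (s := 1) (p := i) (by rwa [ball_one]) hB hdis
      have h4 : tailH α 1 r ≤ f r := by simpa using hαf 1 r le_rfl
      have h5 : 2 * tailH α 1 r * ‖A‖ * ‖B‖ ≤ 2 * tailH α 1 r * 1 * 1 := by
        have := tailH_nonneg α 1 r
        gcongr
      have h6 := le_abs_self (32 * f r)
      linarith
  · simp only [← Finset.sum_div]
    ring

end Automorphisms

/-! ### Automorphisms of Lieb–Robinson type are almost locality preserving -/

section LatticeSums

variable {Γ : Type*} [MetricSpace Γ] [DecidableEq Γ] [FiniteBalls Γ] {d : ℕ} {C K : ℝ}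

/-- The shell `m = 0` is the centre alone, to which the sphere bound does not apply; hence `max K 1`
in place of `K`. -/
theorem PolynomialGrowth.card_shell_le (hΓ : PolynomialGrowth Γ d C K) (p : Γ) {s m : ℕ}
    (hs : 1 ≤ s) (hm : m < s) :
    (((ball p s).filter fun i => ⌈dist p i⌉₊ = m).card : ℝ) ≤ max K 1 * (s : ℝ) ^ (d - 1) := by
  have hs' : (1 : ℝ) ≤ s := by exact_mod_cast hs
  rcases Nat.eq_zero_or_pos m with rfl | hm0
  · have h1 : ((ball p s).filter fun i => ⌈dist p i⌉₊ = 0) ⊆ {p} := by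
      intro i hi
      have := (Finset.mem_filter.1 hi).2
      rw [Nat.ceil_eq_zero, dist_le_zero] at this
      simp [this]
    have h2 := Finset.card_le_card h1
    rw [Finset.card_singleton] at h2
    have h3 : ((((ball p s).filter fun i => ⌈dist p i⌉₊ = 0).card : ℕ) : ℝ) ≤ 1 := by
      exact_mod_cast h2
    exact h3.trans (one_le_mul_of_one_le_of_one_le (le_max_right _ _) (one_le_pow₀ hs'))
  · have h1 : ((ball p s).filter fun i => ⌈dist p i⌉₊ = m) ⊆ sphere p (m + 1) := by
      intro i hi
      have h2 := (Finset.mem_filter.1 hi).2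
      rw [Nat.ceil_eq_iff hm0.ne'] at h2
      rw [sphere, Finset.mem_sdiff, mem_ball, mem_ball, Nat.add_sub_cancel, not_le]
      rw [Nat.cast_sub hm0, Nat.cast_one] at h2
      push_cast
      exact ⟨by linarith [h2.2], h2.1⟩
    have h2 : (((ball p s).filter fun i => ⌈dist p i⌉₊ = m).card : ℝ) ≤
        (sphere p (m + 1)).card := by exact_mod_cast Finset.card_le_card h1
    refine (h2.trans (hΓ.card_sphere_le p m hm0)).trans ?_
    have : (m : ℝ) ≤ s := by exact_mod_cast hm.le
    gcongr
    · exact le_max_left _ _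

/-- A point of `ball p s` at depth `k` below the boundary is at distance more than `r + k` from `Θ`.
Spheres around it give the sum over `l` with the factor `K`, and the cardinality of each depth gives
`s ^ (d - 1)` times the sum over `k`. -/
theorem PolynomialGrowth.sum_ball_sum_le (hΓ : PolynomialGrowth Γ d C K) {F : ℝ≥0 → ℝ≥0}
    (hF : Antitone F) (p : Γ) {s r : ℕ} (hs : 1 ≤ s) {Θ : Finset Γ}
    (hΘ : Disjoint (ball p (s + r)) Θ) :
    ∑ i ∈ ball p s, ∑ j ∈ Θ, (F (nndist i j) : ℝ≥0∞) ≤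
      ENNReal.ofReal (max K 1 * (s : ℝ) ^ (d - 1)) * (ENNReal.ofReal K * gF d F r) := by
  -- The ball `ball p s` has radius `s - 1`, so this subtraction does not truncate on it.
  let k : Γ → ℕ := fun i => s - 1 - ⌈dist p i⌉₊
  have hk : ∀ i ∈ ball p s, ⌈dist p i⌉₊ + k i + 1 = s := by
    intro i hi
    rw [mem_ball] at hi
    have : ⌈dist p i⌉₊ ≤ s - 1 := Nat.ceil_le.2 (by rw [Nat.cast_sub hs]; simpa using hi)
    simp only [k]
    omega
  let h : ℕ → ℝ≥0∞ := fun k => ∑' l : ℕ, ENNReal.ofReal K *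
    ((r + k + l + 1 : ℕ) : ℝ≥0∞) ^ (d - 1) * (F (r + k + l : ℕ) : ℝ≥0∞)
  have h1 : ∀ i ∈ ball p s, ∑ j ∈ Θ, (F (nndist i j) : ℝ≥0∞) ≤ h (k i) := by
    intro i hi
    refine le_trans ?_ (hΓ.tsum_compl_ball_le (G := fun x => (F x : ℝ≥0∞))
      (fun a b h => ENNReal.coe_le_coe.2 (hF h)) i (r + k i))
    refine le_trans (Finset.sum_le_sum fun j hj => ?_) (ENNReal.sum_le_tsum Θ)
    have hj' : j ∉ ball p (s + r) := fun h => Finset.disjoint_left.1 hΘ h hj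
    rw [if_neg]
    rw [mem_ball, not_le] at hj' ⊢
    have h2 := dist_triangle p i j
    have h3 := Nat.le_ceil (dist p i)
    have h4 : (⌈dist p i⌉₊ : ℝ) + k i + 1 = s := by exact_mod_cast hk i hi
    push_cast at hj' ⊢
    linarith
  have h2 : ∀ i ∈ ball p s, h (k i) ≤ ∑' m : ℕ, if k i = m then h m else 0 := by
    intro i _
    refine le_trans ?_ (ENNReal.le_tsum (k i))
    rw [if_pos rfl]
  have h3 : ∀ m, ∑ i ∈ ball p s, (if k i = m then h m else 0) ≤
      ENNReal.ofReal (max K 1 * (s : ℝ) ^ (d - 1)) * h m := by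
    intro m
    rw [← Finset.sum_filter, Finset.sum_const, nsmul_eq_mul]
    gcongr
    by_cases hm : m < s
    · have h4 : ((ball p s).filter fun i => k i = m) ⊆
          (ball p s).filter fun i => ⌈dist p i⌉₊ = s - 1 - m := by
        intro i hi
        rw [Finset.mem_filter] at hi ⊢
        have := hk i hi.1
        exact ⟨hi.1, by omega⟩
      rw [← ENNReal.ofReal_natCast]
      refine ENNReal.ofReal_le_ofReal
        (le_trans ?_ (hΓ.card_shell_le p hs (m := s - 1 - m) (by omega)))
      exact_mod_cast Finset.card_le_card h4
    · have h4 : ((ball p s).filter fun i => k i = m) = ∅ := by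
        refine Finset.filter_eq_empty_iff.2 fun i hi => ?_
        have := hk i hi
        omega
      rw [h4]
      simp
  calc ∑ i ∈ ball p s, ∑ j ∈ Θ, (F (nndist i j) : ℝ≥0∞)
      ≤ ∑ i ∈ ball p s, ∑' m : ℕ, if k i = m then h m else 0 :=
        Finset.sum_le_sum fun i hi => (h1 i hi).trans (h2 i hi)
    _ = ∑' m : ℕ, ∑ i ∈ ball p s, if k i = m then h m else 0 :=
        (Summable.tsum_finsetSum fun _ _ => ENNReal.summable).symm
    _ ≤ ∑' m : ℕ, ENNReal.ofReal (max K 1 * (s : ℝ) ^ (d - 1)) * h m :=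
        ENNReal.tsum_le_tsum h3
    _ = _ := by
        simp_rw [h, mul_assoc, ENNReal.tsum_mul_left]
        rfl

end LatticeSums

/-- The double-sum estimate bounds commutators with everything outside `ball p (s + r)`, and almost
commuting with the outside means being almost local. -/
theorem IsLiebRobinson.isALP {Γ : Type*} [MetricSpace Γ] [DecidableEq Γ] [FiniteBalls Γ] {d : ℕ}
    {C K : ℝ} (hΓ : PolynomialGrowth Γ d C K) {n : Γ → ℕ} [∀ j, NeZero (n j)]
    {α : quasiLocal n ≃⋆ₐ[ℂ] quasiLocal n} (hα : IsLiebRobinson d K α) : IsALP d α := by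
  obtain ⟨F, hF⟩ := hα
  have hK := hΓ.K_pos
  -- The bound is `2 * max K 1 * K * gF d F r` times `s ^ (d - 1)`; dividing by `K` adjusts the `K ^
  -- 2` in `hF.schwartz`. The value at `0` is reset to `1` to match `tailH α s 0 = 1`.
  refine ⟨_, (hF.schwartz.const_mul (2 * max K 1 / K)).update_zero 1, fun s r hs => ?_⟩
  have hs' : (1 : ℝ) ≤ s := by exact_mod_cast hs
  rcases eq_or_ne r 0 with rfl | hr
  · simpa [tailH] using one_le_pow₀ hs'
  · simp only [hr, if_false]
    have h0 : 0 ≤ (s : ℝ) ^ (d - 1) * (2 * max K 1 / K * (K ^ 2 * (gF d F r).toReal)) := by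
      positivity
    rw [tailH, if_neg hr]
    refine Real.iSup_le (fun p => Real.iSup_le (fun A => ?_) h0) h0
    have key : ∀ Θ : Finset Γ, Disjoint (ball p (s + r)) Θ → ∀ B ∈ localAlg n Θ, ‖B‖ ≤ 1 →
        ‖α A * B - B * α A‖ ≤ max K 1 * (s : ℝ) ^ (d - 1) * (K * (gF d F r).toReal) := by
      intro Θ hΘ B hB hB1
      have h1 := ENNReal.toReal_mono (ENNReal.mul_ne_top ENNReal.ofReal_ne_top
        (ENNReal.mul_ne_top ENNReal.ofReal_ne_top (hF.gF_ne_top r)))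
        (hΓ.sum_ball_sum_le hF.antitone p hs hΘ)
      rw [ENNReal.toReal_mul, ENNReal.toReal_mul, ENNReal.toReal_ofReal (by positivity),
        ENNReal.toReal_ofReal hK.le] at h1
      have h2 : (∑ i ∈ ball p s, ∑ j ∈ Θ, (F (nndist i j) : ℝ≥0∞)).toReal =
          ∑ i ∈ ball p s, ∑ j ∈ Θ, (F (nndist i j) : ℝ) := by
        simp_rw [← ENNReal.ofNNReal_finsetSum, ENNReal.coe_toReal]
        push_cast
        rfl
      rw [h2] at h1
      refine (hF.commutator_le _ _ _ _ A.2.1 hB).trans (le_trans ?_ h1)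
      rw [A.2.2, one_mul]
      exact mul_le_of_le_one_left (Finset.sum_nonneg fun i _ => Finset.sum_nonneg fun j _ =>
        NNReal.coe_nonneg _) hB1
    refine (iInf_norm_sub_le_of_commutator_le key).trans (le_of_eq ?_)
    field_simp

end SpinLattice

end

theorem mainTheorem2 {Γ : Type*} [MetricSpace Γ] [DecidableEq Γ] [FiniteBalls Γ]
    {d : ℕ} (hd : 1 ≤ d) {C K : ℝ} (hΓ : PolynomialGrowth Γ d C K)
    (n : Γ → ℕ) [∀ j, NeZero (n j)] (α : quasiLocal n ≃⋆ₐ[ℂ] quasiLocal n) :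
    (IsALP d α → ∃ F : ℝ≥0 → ℝ≥0,
      IsLRFunction d K α F ∧ IsSchwartzSeq fun r : ℕ => (F (r : ℝ≥0) : ℝ)) ∧
    (IsLiebRobinson d K α ↔ IsALP d α) := by
  refine ⟨fun h => h.exists_isLRFunction hd hΓ, fun h => h.isALP hΓ, fun h => ?_⟩
  obtain ⟨F, hF, -⟩ := h.exists_isLRFunction hd hΓ
  exact ⟨F, hF⟩
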